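/- Let $T=\Delta(\xi,0,\eta)\subset\mathbb C$ be a non-degenerate isosceles triangle ($|\xi|=|\eta|$), let $\theta=\measuredangle(\xi,0,\eta)$ be its angle at $0$, and let $\gamma>0$ be a real number with $$\lceil\gamma\rceil\,\theta<\frac{\pi}{2}\qquad\text{and}\qquad \theta<60.4^\circ .$$ Let $h(z)=z^\gamma$ be the power map on $T$, that is, $h(0)=0$ and $h(z)=e^{\gamma\,\ell(z)}$ for $z\in T\setminus\{0\}$, where $\ell$ is any continuous branch of the logarithm on $T\setminus\{0\}$. For $q=0,1,2,\dots$ let $T^q$ be the $q$-th level of regular 1-4 subdivision of $T$ ($T^0=T$, and $T^{q+1}$ is obtained from $T^q$ by splitting every face into four triangles by means of its edge midpoints). Let $h^q:T\to\mathbb C$ be the simplicial map obtained by sampling $h$ at the vertices of $T^q$ and extending linearly, i.e. the map that is affine on every face of $T^q$ and agrees with $h$ at every vertex of $T^q$. Then the maps $h^q$ are well defined, every $h^q$ is a homeomorphism of $T$ onto its image, and there is a constant $K\ge 1$, independent of $q$, such that for all $q\ge 0$ $$\mathbf D(h^q)\le K .$$ Here $\mathbf D(h^q)$ is the conformal distortion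 of $h^q$, the maximum over all faces $f$ of $T^q$ of $\Sigma_f/\sigma_f$, where $\Sigma_f\ge\sigma_f$ are the singular values of the linear part of the affine map $h^q|_f$. -/

import Mathlib

noncomputable section

namespace PowerMap

/-- A (not necessarily non-degenerate) triangle in the plane, given by its ordered vertices. -/
abbrev Triangle : Type := Fin 3 → ℂ

/-- The closed region spanned by a triangle. -/
def Triangle.region (t : Triangle) : Set ℂ := convexHull ℝ (Set.range t)

/-- The regular 1-4 subdivision of a triangle: the three corner triangles and the middle triangle
cut out by the midpoints of the edges. -/
def Triangle.split (t : Triangle) : Set Triangle :=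
  {![t 0, midpoint ℝ (t 0) (t 1), midpoint ℝ (t 0) (t 2)],
   ![midpoint ℝ (t 0) (t 1), t 1, midpoint ℝ (t 1) (t 2)],
   ![midpoint ℝ (t 0) (t 2), midpoint ℝ (t 1) (t 2), t 2],
   ![midpoint ℝ (t 0) (t 1), midpoint ℝ (t 1) (t 2), midpoint ℝ (t 0) (t 2)]}

/-- The set of faces of the `q`-th level `T^q` of regular 1-4 subdivision of `T`. -/
def subdivision (T : Triangle) : ℕ → Set Triangle
  | 0 => {T}
  | q + 1 => ⋃ t ∈ subdivision T q, t.split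

/-- `h` is, on the set `S`, a branch of the power map `z ↦ z ^ γ` (with value `0` at `0`): away from
the origin, `h z = exp (γ ℓ(z))` for some continuous branch `ℓ` of the logarithm on `S \ {0}`. -/
structure IsPowerBranch (γ : ℝ) (S : Set ℂ) (h : ℂ → ℂ) : Prop where
  map_zero : h 0 = 0
  exists_log : ∃ ℓ : ℂ → ℂ, ContinuousOn ℓ (S \ {0}) ∧
    ∀ z ∈ S \ {0}, Complex.exp (ℓ z) = z ∧ h z = Complex.exp ((γ : ℂ) * ℓ z)

/-- `g` is the simplicial map obtained by sampling `h` at the vertices of the faces in `F` and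
extending by linearity: `g` agrees with `h` at all vertices and is affine on every face. -/
structure IsSimplicialInterpolant (F : Set Triangle) (h g : ℂ → ℂ) : Prop where
  vertex : ∀ t ∈ F, ∀ i, g (t i) = h (t i)
  affine : ∀ t ∈ F, ∃ A : ℂ →ᵃ[ℝ] ℂ, Set.EqOn g A t.region

/-- The conformal distortion of a planar affine map: the ratio of the larger to the smaller singular
value of its linear part (infinite if the smaller one vanishes). -/
def distortion (A : ℂ →ᵃ[ℝ] ℂ) : ENNReal :=
  if A.linear.singularValues 1 = 0 then ⊤
  else ENNReal.ofReal (A.linear.singularValues 0 / A.linear.singularValues 1)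

/-- The conformal distortion of a simplicial map: the largest distortion of the affine maps with
which it agrees on the faces. -/
def simplicialDistortion (F : Set Triangle) (g : ℂ → ℂ) : ENNReal :=
  ⨆ t ∈ F, ⨆ (A : ℂ →ᵃ[ℝ] ℂ) (_ : Set.EqOn g A t.region), distortion A

end PowerMap

end

/-! Division by `ξ` (or by `η`, depending on the orientation) turns `T` into the triangle `1, 0, v`,
where `arg v` is the angle `θ`, with `0 < θ < π/2` and `γθ < π/2`. There `h` becomes a constant
multiple of the principal power, and `(2⁻ᵠ w) ^ γ = 2^(-qγ) w ^ γ`. Hence, up to similarities of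
source and target, all the maps `h^q` are restrictions of a single map `G`: the piecewise affine
interpolation of `w ^ γ` at the lattice points `m + n v`. It suffices that `G` is injective and that
its cells have bounded distortion.

Orientation. For a cell `p, p + 1, p + v` with `p ≠ 0`, divide the image by `p ^ γ`: the edges
become `(1 + u / p) ^ γ - 1` for `u = 1, v`. Their real parts are positive
(`one_lt_re_one_add_cpow`) and their imaginary parts have opposite signs, so the orientation is kept
(`InSector.cross_add_cpow_pos`). In the opposite kind of cell, `p + 1 + v` is farther from `0` than
the two other vertices, and subadditivity of the sine puts its image beyond the image of the
opposite edge (`InSector.cross_sub_cpow_pos`).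

Distortion. Far from the origin the power is almost affine at unit scale: multiplied by `p / p ^ γ`,
the image edges tend to `γ` times the original ones. The ratio of squared edge lengths to area thus
converges along the cofinite filter. Since no image triangle is degenerate, it is bounded over all
cells (`exists_norm_sq_le_mul_cross`), and `distortion_le` turns this into a bound on singular
values.

Injectivity. `G` behaves like polar coordinates: on each row `x + y = s` its argument is strictly
monotone, and along a level line of the argument its real part grows strictly with `s`
(`IsSpread.injOn`). Compactness then makes the interpolant an embedding. -/

namespace PowerMap

open Filter Topology Complex

/-! ### Cross products and arguments in the right half plane -/

/-- The planar cross product. -/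
noncomputable def cross (a b : ℂ) : ℝ := a.re * b.im - a.im * b.re

lemma cross_eq_norm_mul_sin (a b : ℂ) :
    cross a b = ‖a‖ * ‖b‖ * Real.sin (arg b - arg a) := by
  rw [cross, ← norm_mul_cos_arg a, ← norm_mul_cos_arg b, ← norm_mul_sin_arg a,
    ← norm_mul_sin_arg b, Real.sin_sub]
  ring

lemma cross_mul_left_right (c a b : ℂ) : cross (c * a) (c * b) = ‖c‖ ^ 2 * cross a b := by
  rw [← normSq_eq_norm_sq, normSq_apply]
  simp only [cross, mul_re, mul_im]
  ring

lemma abs_arg_lt_of_re_pos {a : ℂ} (ha : 0 < a.re) : |arg a| < Real.pi / 2 :=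
  abs_arg_lt_pi_div_two_iff.2 (Or.inl ha)

lemma arg_lt_arg_of_cross_pos {a b : ℂ} (ha : 0 < a.re) (hb : 0 < b.re) (h : 0 < cross a b) :
    arg a < arg b := by
  by_contra! hle
  have h1 := abs_lt.1 (abs_arg_lt_of_re_pos ha)
  have h2 := abs_lt.1 (abs_arg_lt_of_re_pos hb)
  rw [cross_eq_norm_mul_sin] at h
  have : Real.sin (arg b - arg a) ≤ 0 :=
    Real.sin_nonpos_of_nonpos_of_neg_pi_le (by linarith) (by linarith)
  have := mul_nonpos_of_nonneg_of_nonpos (by positivity : 0 ≤ ‖a‖ * ‖b‖) this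
  linarith

lemma arg_le_arg_of_cross_nonneg {a b : ℂ} (ha : 0 < a.re) (hb : 0 < b.re) (h : 0 ≤ cross a b) :
    arg a ≤ arg b := by
  by_contra! hlt
  have h1 := abs_lt.1 (abs_arg_lt_of_re_pos ha)
  have h2 := abs_lt.1 (abs_arg_lt_of_re_pos hb)
  rw [cross_eq_norm_mul_sin] at h
  have : Real.sin (arg b - arg a) < 0 :=
    Real.sin_neg_of_neg_of_neg_pi_lt (by linarith) (by linarith)
  have ha' : 0 < ‖a‖ := norm_pos_iff.2 (by rintro rfl; simp at ha)
  have hb' : 0 < ‖b‖ := norm_pos_iff.2 (by rintro rfl; simp at hb)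
  have := mul_neg_of_pos_of_neg (by positivity : 0 < ‖a‖ * ‖b‖) this
  linarith

lemma cross_cpow (γ : ℝ) (a b : ℂ) :
    cross (a ^ (γ : ℂ)) (b ^ (γ : ℂ)) =
      ‖a‖ ^ γ * ‖b‖ ^ γ * Real.sin (γ * (arg b - arg a)) := by
  simp only [cross, cpow_ofReal_re, cpow_ofReal_im]
  rw [show γ * (arg b - arg a) = arg b * γ - arg a * γ by ring, Real.sin_sub]
  ring

/-! ### The power map on a sector -/

/-- The closed sector on which the power map of exponent `γ` takes values in the right half plane,
without the origin. -/
structure InSector (γ : ℝ) (z : ℂ) : Prop where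
  re_pos : 0 < z.re
  im_nonneg : 0 ≤ z.im
  mul_arg_lt : γ * arg z < Real.pi / 2

namespace InSector

variable {γ : ℝ} {a b q : ℂ}

lemma norm_pos (h : InSector γ a) : 0 < ‖a‖ :=
  norm_pos_iff.2 (by rintro rfl; simpa using h.re_pos)

lemma ne_zero (h : InSector γ a) : a ≠ 0 := norm_pos_iff.1 h.norm_pos

lemma arg_nonneg (h : InSector γ a) : 0 ≤ arg a := arg_nonneg_iff.2 h.im_nonneg

lemma re_cpow_pos (hγ : 0 < γ) (h : InSector γ a) : 0 < (a ^ (γ : ℂ)).re := by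
  rw [cpow_ofReal_re]
  have h1 := h.norm_pos
  have h2 := h.arg_nonneg
  have h3 := h.mul_arg_lt
  have : 0 < Real.cos (arg a * γ) :=
    Real.cos_pos_of_mem_Ioo ⟨by nlinarith [Real.pi_pos], by linarith⟩
  positivity

lemma mul_arg_sub_lt (hγ : 0 < γ) (ha : InSector γ a) (hb : InSector γ b) :
    γ * (arg b - arg a) < Real.pi / 2 := by
  have h1 := ha.arg_nonneg
  have h2 := hb.mul_arg_lt
  nlinarith

lemma cross_cpow_pos (hγ : 0 < γ) (ha : InSector γ a) (hb : InSector γ b)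
    (h : 0 < cross a b) : 0 < cross (a ^ (γ : ℂ)) (b ^ (γ : ℂ)) := by
  rw [cross_cpow]
  have h1 := ha.norm_pos
  have h2 := hb.norm_pos
  have h3 := sub_pos.2 (arg_lt_arg_of_cross_pos ha.re_pos hb.re_pos h)
  have h4 := mul_arg_sub_lt hγ ha hb
  have : 0 < Real.sin (γ * (arg b - arg a)) :=
    Real.sin_pos_of_pos_of_lt_pi (by positivity) (by linarith [Real.pi_pos])
  positivity

lemma cross_cpow_nonneg (hγ : 0 < γ) (ha : InSector γ a) (hb : InSector γ b)
    (h : 0 ≤ cross a b) : 0 ≤ cross (a ^ (γ : ℂ)) (b ^ (γ : ℂ)) := by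
  rw [cross_cpow]
  have h3 := sub_nonneg.2 (arg_le_arg_of_cross_nonneg ha.re_pos hb.re_pos h)
  have h4 := mul_arg_sub_lt hγ ha hb
  have : 0 ≤ Real.sin (γ * (arg b - arg a)) :=
    Real.sin_nonneg_of_nonneg_of_le_pi (by positivity) (by linarith [Real.pi_pos])
  positivity

/-- A point of the sector spanned by `b` and `a` and farther from the origin than both of them is
mapped beyond the segment that joins the images of `b` and `a`. -/
lemma cross_sub_cpow_pos (hγ : 0 < γ) (ha : InSector γ a) (hb : InSector γ b)
    (hq : InSector γ q) (hba : 0 < cross b a) (hbq : 0 ≤ cross b q) (hqa : 0 ≤ cross q a)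
    (hqa' : ‖a‖ < ‖q‖) (hqb' : ‖b‖ < ‖q‖) :
    0 < cross (a ^ (γ : ℂ) - q ^ (γ : ℂ)) (b ^ (γ : ℂ) - q ^ (γ : ℂ)) := by
  have key : cross (a ^ (γ : ℂ) - q ^ (γ : ℂ)) (b ^ (γ : ℂ) - q ^ (γ : ℂ)) =
      cross (b ^ (γ : ℂ)) (q ^ (γ : ℂ)) + cross (q ^ (γ : ℂ)) (a ^ (γ : ℂ)) -
      cross (b ^ (γ : ℂ)) (a ^ (γ : ℂ)) := by
    simp only [cross, sub_re, sub_im]; ring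
  rw [key, cross_cpow, cross_cpow, cross_cpow]
  have hx0 := sub_nonneg.2 (arg_le_arg_of_cross_nonneg hb.re_pos hq.re_pos hbq)
  have hy0 := sub_nonneg.2 (arg_le_arg_of_cross_nonneg hq.re_pos ha.re_pos hqa)
  have hxy := sub_pos.2 (arg_lt_arg_of_cross_pos hb.re_pos ha.re_pos hba)
  have hx1 := mul_arg_sub_lt hγ hb hq
  have hy1 := mul_arg_sub_lt hγ hq ha
  have hA := Real.rpow_lt_rpow ha.norm_pos.le hqa' hγ
  have hB := Real.rpow_lt_rpow hb.norm_pos.le hqb' hγ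
  have hA0 := Real.rpow_pos_of_pos ha.norm_pos γ
  have hB0 := Real.rpow_pos_of_pos hb.norm_pos γ
  set A := ‖a‖ ^ γ
  set B := ‖b‖ ^ γ
  set Q := ‖q‖ ^ γ
  set x := γ * (arg q - arg b) with hx
  set y := γ * (arg a - arg q) with hy
  have hsum : γ * (arg a - arg b) = x + y := by rw [hx, hy]; ring
  have hx0' : 0 ≤ x := by positivity
  have hy0' : 0 ≤ y := by positivity
  have hxy' : 0 < x + y := by rw [← hsum]; positivity
  rw [hsum, Real.sin_add]
  have hsx : 0 ≤ Real.sin x := Real.sin_nonneg_of_nonneg_of_le_pi hx0' (by linarith [Real.pi_pos])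
  have hsy : 0 ≤ Real.sin y := Real.sin_nonneg_of_nonneg_of_le_pi hy0' (by linarith [Real.pi_pos])
  -- Bounding the cosines by `1` gives `sin (x + y) ≤ sin x + sin y`. The goal then dominates `B (Q
  -- - A) sin x + A (Q - B) sin y`, which is positive because `x` and `y` are not both zero.
  have h1 : B * A * (Real.sin x * Real.cos y) ≤ B * A * Real.sin x :=
    mul_le_mul_of_nonneg_left (mul_le_of_le_one_right hsx (Real.cos_le_one y)) (by positivity)
  have h2 : B * A * (Real.cos x * Real.sin y) ≤ B * A * Real.sin y :=
    mul_le_mul_of_nonneg_left (mul_le_of_le_one_left hsy (Real.cos_le_one x)) (by positivity)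
  have hBA : 0 < B * (Q - A) := mul_pos hB0 (sub_pos.2 hA)
  have hAB : 0 < A * (Q - B) := mul_pos hA0 (sub_pos.2 hB)
  have : 0 < B * (Q - A) * Real.sin x + A * (Q - B) * Real.sin y := by
    rcases hx0'.eq_or_lt with h | h
    · have : 0 < Real.sin y :=
        Real.sin_pos_of_pos_of_lt_pi (by linarith) (by linarith [Real.pi_pos])
      have := mul_pos hAB this
      have := mul_nonneg hBA.le hsx
      linarith
    · have : 0 < Real.sin x := Real.sin_pos_of_pos_of_lt_pi h (by linarith [Real.pi_pos])
      have := mul_pos hBA this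
      have := mul_nonneg hAB.le hsy
      linarith
  linarith

end InSector

/-! ### Powers of `1 + w` and the orientation of the triangles `p, p + u, p + v` -/

lemma re_one_add_mul_pos {w : ℂ} (hw : 0 < w.re) {t : ℝ} (ht : 0 ≤ t) :
    0 < (1 + (t : ℂ) * w).re := by
  simp only [add_re, one_re, re_ofReal_mul]
  positivity

lemma arg_one_add_mul_mem {w : ℂ} (hw : 0 < w.re) (hi : 0 ≤ w.im) {t : ℝ} (ht : 0 ≤ t) :
    0 ≤ arg (1 + (t : ℂ) * w) ∧ arg (1 + (t : ℂ) * w) ≤ arg w := by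
  constructor
  · rw [arg_nonneg_iff]
    simp only [add_im, one_im, im_ofReal_mul]
    positivity
  · apply arg_le_arg_of_cross_nonneg (re_one_add_mul_pos hw ht) hw
    simp only [cross, add_re, one_re, add_im, one_im, re_ofReal_mul, im_ofReal_mul]
    linarith

/-- The real part increases along `t ↦ (1 + t w) ^ γ` from its value `1` at `t = 0`. The derivative
`γ (1 + t w) ^ (γ - 1) w` has argument `(γ - 1) arg (1 + t w) + arg w`, and since `0 ≤ arg (1 + t w)
≤ arg w` this lies between `0` and `max 1 γ * arg w`, hence below `π / 2`. -/
lemma one_lt_re_one_add_cpow_of_im_nonneg {γ : ℝ} (hγ : 0 < γ) {w : ℂ} (hw : 0 < w.re)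
    (hi : 0 ≤ w.im) (h : γ * arg w < Real.pi / 2) : 1 < ((1 + w) ^ (γ : ℂ)).re := by
  have hd : ∀ t : ℝ, 0 ≤ t → HasDerivAt (fun t : ℝ => ((1 + (t : ℂ) * w) ^ (γ : ℂ)).re)
      ((γ : ℂ) * (1 + (t : ℂ) * w) ^ ((γ : ℂ) - 1) * w).re t := by
    intro t ht
    have h1 : HasDerivAt (fun z : ℂ => (1 + z * w) ^ (γ : ℂ))
        ((γ : ℂ) * (1 + (t : ℂ) * w) ^ ((γ : ℂ) - 1) * w) (t : ℂ) := by
      have h0 : HasDerivAt (fun z : ℂ => 1 + z * w) w (t : ℂ) := by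
        simpa using ((hasDerivAt_id (t : ℂ)).mul_const w).const_add 1
      exact h0.cpow_const (Or.inl (re_one_add_mul_pos hw ht))
    exact h1.real_of_complex
  have hpos : ∀ t : ℝ, 0 ≤ t → 0 < ((γ : ℂ) * (1 + (t : ℂ) * w) ^ ((γ : ℂ) - 1) * w).re := by
    intro t ht
    obtain ⟨a0, a1⟩ := arg_one_add_mul_mem hw hi ht
    have hr := re_one_add_mul_pos hw ht
    set z := 1 + (t : ℂ) * w
    have hz : 0 < ‖z‖ := norm_pos_iff.2 (by intro h; simp [h] at hr)
    have hw' : 0 < ‖w‖ := norm_pos_iff.2 (by rintro rfl; simp at hw)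
    have e : ((γ : ℂ) * z ^ ((γ : ℂ) - 1) * w).re =
        γ * (‖z‖ ^ (γ - 1) * ‖w‖ * Real.cos (arg z * (γ - 1) + arg w)) := by
      rw [show ((γ : ℂ) - 1) = ((γ - 1 : ℝ) : ℂ) by simp, mul_assoc, re_ofReal_mul, mul_re,
        cpow_ofReal_re, cpow_ofReal_im, ← norm_mul_cos_arg w, ← norm_mul_sin_arg w, Real.cos_add]
      ring
    rw [e]
    have hw2 := abs_lt.1 (abs_arg_lt_of_re_pos hw)
    have : 0 < Real.cos (arg z * (γ - 1) + arg w) := by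
      apply Real.cos_pos_of_mem_Ioo
      constructor
      · nlinarith [Real.pi_pos]
      · rcases le_total γ 1 with h1 | h1 <;> nlinarith
    positivity
  have hmono : StrictMonoOn (fun t : ℝ => ((1 + (t : ℂ) * w) ^ (γ : ℂ)).re) (Set.Icc 0 1) := by
    apply strictMonoOn_of_deriv_pos (convex_Icc 0 1)
    · intro t ht
      exact (hd t ht.1).continuousAt.continuousWithinAt
    · intro t ht
      rw [interior_Icc] at ht
      rw [(hd t ht.1.le).deriv]
      exact hpos t ht.1.le
  have := hmono (Set.left_mem_Icc.2 zero_le_one) (Set.right_mem_Icc.2 zero_le_one) zero_lt_one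
  simpa using this

lemma conj_one_add_cpow (γ : ℝ) {w : ℂ} (hw : 0 < w.re) :
    (1 + (starRingEnd ℂ) w) ^ (γ : ℂ) = (starRingEnd ℂ) ((1 + w) ^ (γ : ℂ)) := by
  have hr : 0 < (1 + w).re := by simp only [add_re, one_re]; linarith
  have hne : arg (1 + w) ≠ Real.pi := by
    have := abs_lt.1 (abs_arg_lt_of_re_pos hr)
    linarith [Real.pi_pos]
  have e : (1 + (starRingEnd ℂ) w) = (starRingEnd ℂ) (1 + w) := by simp
  rw [e, conj_cpow _ _ hne, conj_ofReal]

lemma arg_conj_of_re_pos {w : ℂ} (hw : 0 < w.re) : arg ((starRingEnd ℂ) w) = - arg w := by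
  have := abs_lt.1 (abs_arg_lt_of_re_pos hw)
  rw [arg_conj, if_neg (by linarith [Real.pi_pos])]

lemma one_lt_re_one_add_cpow {γ : ℝ} (hγ : 0 < γ) {w : ℂ} (hw : 0 < w.re)
    (h : γ * |arg w| < Real.pi / 2) : 1 < ((1 + w) ^ (γ : ℂ)).re := by
  rcases le_total 0 w.im with hi | hi
  · rw [abs_of_nonneg (arg_nonneg_iff.2 hi)] at h
    exact one_lt_re_one_add_cpow_of_im_nonneg hγ hw hi h
  · have := one_lt_re_one_add_cpow_of_im_nonneg (w := (starRingEnd ℂ) w) hγ (by simpa using hw)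
      (by simpa using hi) (by rw [arg_conj_of_re_pos hw]; nlinarith [neg_le_abs (arg w)])
    rwa [conj_one_add_cpow γ hw, conj_re] at this

lemma mul_arg_one_add_lt {γ : ℝ} (hγ : 0 < γ) {w : ℂ} (hw : 0 < w.re) (hi : 0 ≤ w.im)
    (h : γ * arg w < Real.pi / 2) : arg (1 + w) * γ < Real.pi / 2 := by
  have := (arg_one_add_mul_mem hw hi zero_le_one).2
  rw [ofReal_one, one_mul] at this
  nlinarith

lemma im_one_add_cpow_nonneg {γ : ℝ} (hγ : 0 < γ) {w : ℂ} (hw : 0 < w.re) (hi : 0 ≤ w.im)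
    (h : γ * arg w < Real.pi / 2) : 0 ≤ ((1 + w) ^ (γ : ℂ)).im := by
  have h0 : 0 ≤ arg (1 + w) := by rw [arg_nonneg_iff]; simpa using hi
  rw [cpow_ofReal_im]
  have := Real.sin_nonneg_of_nonneg_of_le_pi (mul_nonneg h0 hγ.le)
    (by linarith [mul_arg_one_add_lt hγ hw hi h, Real.pi_pos])
  positivity

lemma im_one_add_cpow_pos {γ : ℝ} (hγ : 0 < γ) {w : ℂ} (hw : 0 < w.re) (hi : 0 < w.im)
    (h : γ * arg w < Real.pi / 2) : 0 < ((1 + w) ^ (γ : ℂ)).im := by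
  have h0 : 0 < arg (1 + w) := by
    refine lt_of_le_of_ne (by rw [arg_nonneg_iff]; simpa using hi.le) fun h0 => ?_
    have := (arg_eq_zero_iff.1 h0.symm).2
    simp at this
    linarith
  have hz : 0 < ‖1 + w‖ := norm_pos_iff.2 (by rintro h1; rw [h1] at h0; simp at h0)
  rw [cpow_ofReal_im]
  have := Real.sin_pos_of_pos_of_lt_pi (mul_pos h0 hγ)
    (by linarith [mul_arg_one_add_lt hγ hw hi.le h, Real.pi_pos])
  positivity

/-- Both arguments lie in `(-π/2, π/2)`, so their sum stays in the range of the principal branch. -/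
lemma mul_cpow_of_re_pos {a b : ℂ} (ha : 0 < a.re) (hb : 0 < b.re) (c : ℂ) :
    (a * b) ^ c = a ^ c * b ^ c := by
  have ha' : a ≠ 0 := by rintro rfl; simp at ha
  have hb' : b ≠ 0 := by rintro rfl; simp at hb
  have h1 := abs_lt.1 (abs_arg_lt_of_re_pos ha)
  have h2 := abs_lt.1 (abs_arg_lt_of_re_pos hb)
  rw [cpow_def_of_ne_zero ha', cpow_def_of_ne_zero hb', cpow_def_of_ne_zero (mul_ne_zero ha' hb'),
    Complex.log_mul ha' hb' ⟨by linarith, by linarith⟩, add_mul, Complex.exp_add]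

lemma add_cpow_sub_cpow {p u : ℂ} (hp : 0 < p.re) (hu : 0 < (1 + u / p).re) (c : ℂ) :
    (p + u) ^ c - p ^ c = p ^ c * ((1 + u / p) ^ c - 1) := by
  have hp' : p ≠ 0 := by rintro rfl; simp at hp
  rw [show p + u = p * (1 + u / p) by field_simp, mul_cpow_of_re_pos hp hu]
  ring

lemma re_pos_of_abs_arg_lt {z : ℂ} (hz : z ≠ 0) (h : |arg z| < Real.pi / 2) : 0 < z.re :=
  (abs_arg_lt_pi_div_two_iff.1 h).resolve_right hz

lemma arg_div_of_re_pos {a b : ℂ} (ha : 0 < a.re) (hb : 0 < b.re) :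
    arg (b / a) = arg b - arg a := by
  have ha' : a ≠ 0 := by rintro rfl; simp at ha
  have hb' : b ≠ 0 := by rintro rfl; simp at hb
  have h1 := abs_lt.1 (abs_arg_lt_of_re_pos ha)
  have h2 := abs_lt.1 (abs_arg_lt_of_re_pos hb)
  have hne : arg a ≠ Real.pi := by linarith [Real.pi_pos]
  rw [div_eq_mul_inv, arg_mul hb' (inv_ne_zero ha')
    (by rw [arg_inv, if_neg hne]; constructor <;> linarith),
    arg_inv, if_neg hne]
  ring

/-- Let `p`, `u` and `v` lie in the sector and let `p` lie between the rays spanned by `u` and `v`.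
The power map preserves the orientation of the triangle `p`, `p + u`, `p + v`. -/
lemma InSector.cross_add_cpow_pos {γ : ℝ} (hγ : 0 < γ) {p u v : ℂ} (hp : InSector γ p)
    (hu : InSector γ u) (hv : InSector γ v) (huv : 0 < cross u v) (hup : 0 ≤ cross u p)
    (hpv : 0 ≤ cross p v) :
    0 < cross ((p + u) ^ (γ : ℂ) - p ^ (γ : ℂ)) ((p + v) ^ (γ : ℂ) - p ^ (γ : ℂ)) := by
  have hp0 := hp.norm_pos
  have argu := arg_div_of_re_pos hp.re_pos hu.re_pos
  have argv := arg_div_of_re_pos hp.re_pos hv.re_pos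
  have l1 := arg_le_arg_of_cross_nonneg hu.re_pos hp.re_pos hup
  have l2 := arg_le_arg_of_cross_nonneg hp.re_pos hv.re_pos hpv
  have l3 := arg_lt_arg_of_cross_pos hu.re_pos hv.re_pos huv
  have absu : |arg (u / p)| ≤ arg p := by
    rw [argu, abs_of_nonpos (by linarith)]; linarith [hu.arg_nonneg]
  have absv : |arg (v / p)| ≤ arg v := by
    rw [argv, abs_of_nonneg (by linarith)]; linarith [hp.arg_nonneg]
  have ru : 0 < (u / p).re := re_pos_of_abs_arg_lt (div_ne_zero hu.ne_zero hp.ne_zero)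
    (absu.trans_lt ((le_abs_self _).trans_lt (abs_arg_lt_of_re_pos hp.re_pos)))
  have rv : 0 < (v / p).re := re_pos_of_abs_arg_lt (div_ne_zero hv.ne_zero hp.ne_zero)
    (absv.trans_lt ((le_abs_self _).trans_lt (abs_arg_lt_of_re_pos hv.re_pos)))
  have ru1 : 0 < (1 + u / p).re := by simp only [add_re, one_re]; linarith
  have rv1 : 0 < (1 + v / p).re := by simp only [add_re, one_re]; linarith
  rw [add_cpow_sub_cpow hp.re_pos ru1, add_cpow_sub_cpow hp.re_pos rv1, cross_mul_left_right]
  have hX := one_lt_re_one_add_cpow hγ ru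
    ((mul_le_mul_of_nonneg_left absu hγ.le).trans_lt hp.mul_arg_lt)
  have hY := one_lt_re_one_add_cpow hγ rv
    ((mul_le_mul_of_nonneg_left absv hγ.le).trans_lt hv.mul_arg_lt)
  have hpc : 0 < ‖p ^ (γ : ℂ)‖ := norm_pos_iff.2 (by simp [cpow_eq_zero_iff, hp.ne_zero])
  have cu : cross p u = ‖p‖ ^ 2 * (u / p).im := by
    have := cross_mul_left_right p 1 (u / p)
    rw [mul_one, mul_div_cancel₀ _ hp.ne_zero] at this
    simpa [cross] using this
  have cv : cross p v = ‖p‖ ^ 2 * (v / p).im := by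
    have := cross_mul_left_right p 1 (v / p)
    rw [mul_one, mul_div_cancel₀ _ hp.ne_zero] at this
    simpa [cross] using this
  have cup : cross u p = - cross p u := by simp only [cross]; ring
  rw [cup, cu] at hup
  rw [cv] at hpv
  have hp2 : 0 < ‖p‖ ^ 2 := by positivity
  have iv : 0 ≤ (v / p).im := nonneg_of_mul_nonneg_right hpv hp2
  have iu : (u / p).im ≤ 0 := by
    by_contra! hlt
    have := mul_pos hp2 hlt
    linarith
  rw [abs_of_nonneg (arg_nonneg_iff.2 iv)] at absv
  have hv1 : γ * arg (v / p) < Real.pi / 2 :=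
    (mul_le_mul_of_nonneg_left absv hγ.le).trans_lt hv.mul_arg_lt
  have ru' : 0 < ((starRingEnd ℂ) (u / p)).re := by rwa [conj_re]
  have hu1 : γ * arg ((starRingEnd ℂ) (u / p)) < Real.pi / 2 := by
    rw [arg_conj_of_re_pos ru]
    have := mul_le_mul_of_nonneg_left ((neg_le_abs _).trans absu) hγ.le
    exact this.trans_lt hp.mul_arg_lt
  have Yi := im_one_add_cpow_nonneg hγ rv iv hv1
  have Xi := im_one_add_cpow_nonneg hγ ru' (by rw [conj_im]; linarith) hu1
  rw [conj_one_add_cpow γ ru, conj_im] at Xi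
  refine mul_pos (by positivity) ?_
  simp only [cross, sub_re, sub_im, one_re, one_im, sub_zero]
  -- Both edge vectors have positive real part, the first has imaginary part `≤ 0` and the second `≥
  -- 0`. One of these is strict, since otherwise `u` and `v` would both be parallel to `p`, against
  -- `arg u < arg v`.
  rcases iv.lt_or_eq with iv' | iv'
  · have := im_one_add_cpow_pos hγ rv iv' hv1
    nlinarith
  · have iu' : 0 < ((starRingEnd ℂ) (u / p)).im := by
      rw [conj_im]
      refine lt_of_le_of_ne (by linarith) fun h0 => ?_
      have a1 : arg (v / p) = 0 := arg_eq_zero_iff.2 ⟨rv.le, iv'.symm⟩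
      have a2 : arg (u / p) = 0 := arg_eq_zero_iff.2 ⟨ru.le, by linarith⟩
      linarith
    have := im_one_add_cpow_pos hγ ru' iu' hu1
    rw [conj_one_add_cpow γ ru, conj_im] at this
    nlinarith

/-! ### Lattice samples of the power map and their asymptotic shape -/

/-- The lattice spanned by `1` and `v`. -/
noncomputable def latticePoint (v : ℂ) (k : ℕ × ℕ) : ℂ := k.1 + k.2 * v

/-- The values of the power map at the lattice points. -/
noncomputable def latticePower (γ : ℝ) (v : ℂ) (k : ℕ × ℕ) : ℂ := latticePoint v k ^ (γ : ℂ)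

lemma latticePoint_re (v : ℂ) (k : ℕ × ℕ) : (latticePoint v k).re = k.1 + k.2 * v.re := by
  simp [latticePoint]

lemma latticePoint_im (v : ℂ) (k : ℕ × ℕ) : (latticePoint v k).im = k.2 * v.im := by
  simp [latticePoint]

lemma cross_latticePoint (v : ℂ) (k l : ℕ × ℕ) :
    cross (latticePoint v k) (latticePoint v l) = (k.1 * l.2 - k.2 * l.1) * v.im := by
  simp only [cross, latticePoint_re, latticePoint_im]; ring

lemma tendsto_norm_latticePoint {v : ℂ} (hv : 0 < v.re) :
    Tendsto (fun k => ‖latticePoint v k‖) cofinite atTop := by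
  rw [tendsto_atTop]
  intro b
  rw [eventually_cofinite]
  obtain ⟨M, hM⟩ := exists_nat_ge (max b (b / v.re))
  refine ((Set.finite_Iic M).prod (Set.finite_Iic M)).subset fun k hk => ?_
  have hk : ‖latticePoint v k‖ < b := not_le.1 hk
  have h1 := (re_le_norm (latticePoint v k)).trans_lt hk
  rw [latticePoint_re] at h1
  have h2 : (0 : ℝ) ≤ k.1 := by positivity
  have h3 : (0 : ℝ) ≤ k.2 * v.re := by positivity
  constructor
  · have : (k.1 : ℝ) ≤ M := by linarith [le_max_left b (b / v.re)]
    exact_mod_cast this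
  · have : (k.2 : ℝ) ≤ M := by
      have : (k.2 : ℝ) ≤ b / v.re := by rw [le_div_iff₀ hv]; linarith
      linarith [le_max_right b (b / v.re)]
    exact_mod_cast this

/-- With `p` the lattice point and `x = u / p → 0`, the expression is `u` times the difference
quotient `((1 + x) ^ γ - 1) / x`, whose limit at `0` is `γ`. Using `dslope` avoids a case
distinction at `x = 0`. -/
lemma tendsto_latticePoint_mul_cpow_sub (γ : ℝ) {v : ℂ} (hv : 0 < v.re) (u : ℂ) :
    Tendsto (fun k => latticePoint v k / latticePower γ v k *
      ((latticePoint v k + u) ^ (γ : ℂ) - latticePower γ v k)) cofinite (𝓝 (u * γ)) := by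
  set F : ℂ → ℂ := dslope (fun x : ℂ => (1 + x) ^ (γ : ℂ)) 0 with hF
  have hd : HasDerivAt (fun x : ℂ => (1 + x) ^ (γ : ℂ)) (γ : ℂ) 0 := by
    simpa using ((hasDerivAt_id (0 : ℂ)).const_add 1).cpow_const (c := (γ : ℂ)) (by simp)
  have hF0 : F 0 = γ := by rw [hF, dslope_same, hd.deriv]
  have hFc : ContinuousAt F 0 := by
    rw [hF, continuousAt_dslope_same]; exact hd.differentiableAt
  have hx : Tendsto (fun k => u / latticePoint v k) cofinite (𝓝 0) := by
    rw [tendsto_zero_iff_norm_tendsto_zero]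
    simp only [norm_div]
    exact (tendsto_norm_latticePoint hv).const_div_atTop _
  have hlim : Tendsto (fun k => u * F (u / latticePoint v k)) cofinite (𝓝 (u * γ)) := by
    rw [← hF0]
    exact (hFc.tendsto.comp hx).const_mul u
  refine hlim.congr' ?_
  have hre : ∀ᶠ k in cofinite, 0 < (1 + u / latticePoint v k).re := by
    have : Tendsto (fun k => (1 + u / latticePoint v k).re) cofinite (𝓝 (1 + (0 : ℂ)).re) :=
      (continuous_re.tendsto _).comp (hx.const_add 1)
    exact this.eventually_const_lt (by simp)
  filter_upwards [hre, (tendsto_norm_latticePoint hv).eventually_gt_atTop 0] with k hk1 hk2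
  have hne : latticePoint v k ≠ 0 := norm_pos_iff.1 hk2
  have hp : 0 < (latticePoint v k).re := by
    have h0 : k.1 ≠ 0 ∨ k.2 ≠ 0 := by
      by_contra! h
      exact hne (by simp [latticePoint, h.1, h.2])
    rw [latticePoint_re]
    rcases h0 with h0 | h0
    · have : (0 : ℝ) < k.1 := by positivity
      positivity
    · have : (0 : ℝ) < k.2 := by positivity
      positivity
  have hpc : latticePoint v k ^ (γ : ℂ) ≠ 0 := by simp [cpow_eq_zero_iff, hne]
  have hsl : (1 + u / latticePoint v k) ^ (γ : ℂ) - 1 =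
      u / latticePoint v k * F (u / latticePoint v k) := by
    have := sub_smul_dslope (fun x : ℂ => (1 + x) ^ (γ : ℂ)) 0 (u / latticePoint v k)
    simp only [sub_zero, add_zero, one_cpow, smul_eq_mul] at this
    exact this.symm
  rw [latticePower, add_cpow_sub_cpow hp hk1, hsl]
  field_simp

/-- The images of the two edges of a lattice triangle are comparable to its area. -/
lemma exists_norm_sq_le_mul_cross (γ : ℝ) (hγ : 0 < γ) {v : ℂ} (hv : 0 < v.re) (hvi : 0 < v.im)
    {ι : Type*} (φ : ι → ℕ × ℕ) (hφ : Function.Injective φ) {ε : ℂ} (hε : ε ≠ 0)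
    (hpos : ∀ i, 0 < cross ((latticePoint v (φ i) + ε) ^ (γ : ℂ) - latticePower γ v (φ i))
      ((latticePoint v (φ i) + ε * v) ^ (γ : ℂ) - latticePower γ v (φ i))) :
    ∃ K : ℝ, ∀ i,
      ‖(latticePoint v (φ i) + ε) ^ (γ : ℂ) - latticePower γ v (φ i)‖ ^ 2 +
      ‖(latticePoint v (φ i) + ε * v) ^ (γ : ℂ) - latticePower γ v (φ i)‖ ^ 2 ≤
      K * cross ((latticePoint v (φ i) + ε) ^ (γ : ℂ) - latticePower γ v (φ i))
      ((latticePoint v (φ i) + ε * v) ^ (γ : ℂ) - latticePower γ v (φ i)) := by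
  set U := fun i => (latticePoint v (φ i) + ε) ^ (γ : ℂ) - latticePower γ v (φ i)
  set V := fun i => (latticePoint v (φ i) + ε * v) ^ (γ : ℂ) - latticePower γ v (φ i)
  set c := fun i => latticePoint v (φ i) / latticePower γ v (φ i)
  have hU : Tendsto (fun i => c i * U i) cofinite (𝓝 (ε * γ)) :=
    (tendsto_latticePoint_mul_cpow_sub γ hv ε).comp hφ.tendsto_cofinite
  have hV : Tendsto (fun i => c i * V i) cofinite (𝓝 (ε * v * γ)) :=
    (tendsto_latticePoint_mul_cpow_sub γ hv (ε * v)).comp hφ.tendsto_cofinite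
  have hcross : Tendsto (fun i => cross (c i * U i) (c i * V i)) cofinite
      (𝓝 (cross (ε * γ) (ε * v * γ))) := by
    simp only [cross]
    exact (((continuous_re.tendsto _).comp hU).mul ((continuous_im.tendsto _).comp hV)).sub
      (((continuous_im.tendsto _).comp hU).mul ((continuous_re.tendsto _).comp hV))
  have hne : cross (ε * γ) (ε * v * γ) ≠ 0 := by
    rw [show ε * v * γ = ε * γ * v by ring, show cross (ε * γ) (ε * γ * v) =
      cross (ε * γ * 1) (ε * γ * v) by rw [mul_one], cross_mul_left_right]
    have : 0 < ‖ε * (γ : ℂ)‖ := norm_pos_iff.2 (mul_ne_zero hε (by exact_mod_cast hγ.ne'))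
    have h2 : cross 1 v = v.im := by simp [cross]
    rw [h2]
    positivity
  have hR : Tendsto (fun i => (‖c i * U i‖ ^ 2 + ‖c i * V i‖ ^ 2) / cross (c i * U i) (c i * V i))
      cofinite (𝓝 ((‖ε * γ‖ ^ 2 + ‖ε * v * γ‖ ^ 2) / cross (ε * γ) (ε * v * γ))) :=
    ((hU.norm.pow 2).add (hV.norm.pow 2)).div hcross hne
  -- Multiplying both edges by `c i` scales squared lengths and area by the same factor `‖c i‖ ^ 2`,
  -- so the ratio is unchanged.
  have hR' : Tendsto (fun i => (‖U i‖ ^ 2 + ‖V i‖ ^ 2) / cross (U i) (V i))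
      cofinite (𝓝 ((‖ε * γ‖ ^ 2 + ‖ε * v * γ‖ ^ 2) / cross (ε * γ) (ε * v * γ))) := by
    refine hR.congr' ?_
    filter_upwards [((tendsto_norm_latticePoint hv).comp
      hφ.tendsto_cofinite).eventually_gt_atTop 0] with i hi
    have hp : latticePoint v (φ i) ≠ 0 := norm_pos_iff.1 hi
    have hc : 0 < ‖c i‖ := norm_pos_iff.2 (div_ne_zero hp (by simp [latticePower, hp]))
    rw [norm_mul, norm_mul, cross_mul_left_right, mul_pow, mul_pow, ← mul_add,
      mul_div_mul_left _ _ (by positivity)]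
  -- Convergence along the cofinite filter bounds the ratio outside a finite set of cells, hence
  -- everywhere.
  obtain ⟨K, hK⟩ := hR'.bddAbove_range_of_cofinite
  refine ⟨K, fun i => ?_⟩
  have := hK ⟨i, rfl⟩
  rwa [div_le_iff₀ (hpos i)] at this

/-! ### Monotonicity and uniform shape bounds for the lattice samples -/

/-- A function on the lattice quadrant that has the monotonicity properties of the power map: the
arguments of its values increase with the slope, and it preserves the orientation of the two kinds
of lattice triangles. -/
structure IsLatticeSpread (H : ℕ → ℕ → ℂ) : Prop where
  map_zero : H 0 0 = 0
  re_pos : ∀ m n, m ≠ 0 ∨ n ≠ 0 → 0 < (H m n).re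
  cross_nonneg : ∀ m n m' n', n * m' ≤ m * n' → 0 ≤ cross (H m n) (H m' n')
  cross_pos : ∀ m n m' n', n * m' < m * n' → 0 < cross (H m n) (H m' n')
  up : ∀ m n, 0 < cross (H (m + 1) n - H m n) (H m (n + 1) - H m n)
  down : ∀ m n, 0 < cross (H m (n + 1) - H (m + 1) (n + 1)) (H (m + 1) n - H (m + 1) (n + 1))

section LatticePower

variable {γ : ℝ} {v : ℂ}

lemma inSector_latticePoint (hγ : 0 < γ) (hv : InSector γ v) {k : ℕ × ℕ}
    (hk : k.1 ≠ 0 ∨ k.2 ≠ 0) : InSector γ (latticePoint v k) := by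
  have hre := hv.re_pos
  have him := hv.im_nonneg
  have h1 : 0 < (latticePoint v k).re := by
    rw [latticePoint_re]
    rcases hk with h0 | h0
    · have : (0 : ℝ) < k.1 := by positivity
      positivity
    · have : (0 : ℝ) < k.2 := by positivity
      positivity
  refine ⟨h1, by rw [latticePoint_im]; positivity, ?_⟩
  have : arg (latticePoint v k) ≤ arg v := by
    apply arg_le_arg_of_cross_nonneg h1 hre
    simp only [cross, latticePoint_re, latticePoint_im]
    have : (0 : ℝ) ≤ k.1 * v.im := by positivity
    linarith
  exact (mul_le_mul_of_nonneg_left this hγ.le).trans_lt hv.mul_arg_lt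

lemma latticePower_zero (hγ : 0 < γ) : latticePower γ v (0, 0) = 0 := by
  simp [latticePower, latticePoint, hγ.ne']

lemma norm_latticePoint_lt (hv : 0 < v.re) {k l : ℕ × ℕ} (h1 : k.1 ≤ l.1) (h2 : k.2 ≤ l.2)
    (h : k.1 < l.1 ∨ k.2 < l.2) : ‖latticePoint v k‖ < ‖latticePoint v l‖ := by
  have a1 : (k.1 : ℝ) ≤ l.1 := by exact_mod_cast h1
  have a2 : (k.2 : ℝ) ≤ l.2 := by exact_mod_cast h2
  have hre : (latticePoint v k).re < (latticePoint v l).re := by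
    simp only [latticePoint_re]
    rcases h with h | h
    · have : (k.1 : ℝ) < l.1 := by exact_mod_cast h
      nlinarith
    · have : (k.2 : ℝ) < l.2 := by exact_mod_cast h
      nlinarith
  have hre0 : 0 ≤ (latticePoint v k).re := by rw [latticePoint_re]; positivity
  have him : (latticePoint v k).im ^ 2 ≤ (latticePoint v l).im ^ 2 := by
    simp only [latticePoint_im, mul_pow]
    gcongr
  rw [← sq_lt_sq₀ (norm_nonneg _) (norm_nonneg _), ← normSq_eq_norm_sq, ← normSq_eq_norm_sq,
    normSq_apply, normSq_apply]
  nlinarith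

/-- Comparing slopes of lattice points amounts to the sign of their cross product, which the power
map preserves on the sector. The cell at the origin needs separate treatment, because there is no `p
^ γ` to divide by: its image is spanned by `1` and `v ^ γ`. -/
lemma isLatticeSpread_latticePower (hγ : 0 < γ) (hv : InSector γ v) (hvi : 0 < v.im) :
    IsLatticeSpread fun m n => latticePower γ v (m, n) := by
  have sec : ∀ m n : ℕ, m ≠ 0 ∨ n ≠ 0 → InSector γ (latticePoint v (m, n)) :=
    fun m n h => inSector_latticePoint hγ hv h
  have h1 : InSector γ (1 : ℂ) := ⟨by simp, by simp, by simpa using Real.pi_pos⟩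
  have cr : ∀ k l : ℕ × ℕ, k.2 * l.1 ≤ k.1 * l.2 →
      0 ≤ cross (latticePoint v k) (latticePoint v l) := by
    intro k l h
    rw [cross_latticePoint]
    have : (k.2 * l.1 : ℝ) ≤ k.1 * l.2 := by exact_mod_cast h
    exact mul_nonneg (by linarith) hvi.le
  have cr' : ∀ k l : ℕ × ℕ, k.2 * l.1 < k.1 * l.2 →
      0 < cross (latticePoint v k) (latticePoint v l) := by
    intro k l h
    rw [cross_latticePoint]
    have : (k.2 * l.1 : ℝ) < k.1 * l.2 := by exact_mod_cast h
    exact mul_pos (by linarith) hvi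
  refine ⟨latticePower_zero hγ, fun m n h => (sec m n h).re_cpow_pos hγ, ?_, ?_, ?_, ?_⟩
  · intro m n m' n' h
    by_cases hk : m ≠ 0 ∨ n ≠ 0
    · by_cases hl : m' ≠ 0 ∨ n' ≠ 0
      · exact (sec m n hk).cross_cpow_nonneg hγ (sec m' n' hl) (cr _ _ h)
      · push Not at hl
        simp [hl.1, hl.2, latticePower_zero hγ, cross]
    · push Not at hk
      simp [hk.1, hk.2, latticePower_zero hγ, cross]
  · intro m n m' n' h
    have hk : m ≠ 0 ∨ n ≠ 0 := by
      by_contra! hk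
      simp [hk.1] at h
    have hl : m' ≠ 0 ∨ n' ≠ 0 := by
      by_contra! hl
      simp [hl.2] at h
    exact (sec m n hk).cross_cpow_pos hγ (sec m' n' hl) (cr' _ _ h)
  · intro m n
    by_cases hk : m ≠ 0 ∨ n ≠ 0
    · have := (sec m n hk).cross_add_cpow_pos hγ h1 hv (by simpa [cross] using hvi)
        (by simp only [cross, latticePoint_im, latticePoint_re, one_re, one_im]
            nlinarith [mul_nonneg (Nat.cast_nonneg (α := ℝ) n) hvi.le])
        (by simp only [cross, latticePoint_im, latticePoint_re]
            nlinarith [mul_nonneg (Nat.cast_nonneg (α := ℝ) m) hvi.le])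
      convert this using 3
      · simp only [latticePower, latticePoint]; push_cast; ring_nf
      · simp only [latticePower, latticePoint]
      · simp only [latticePower, latticePoint]; push_cast; ring_nf
      · simp only [latticePower, latticePoint]
    · push Not at hk
      obtain ⟨rfl, rfl⟩ := hk
      simp only [latticePower_zero hγ, sub_zero]
      exact (sec 1 0 (by simp)).cross_cpow_pos hγ (sec 0 1 (by simp)) (cr' _ _ (by simp))
  · intro m n
    refine (sec m (n + 1) (by simp)).cross_sub_cpow_pos hγ (sec (m + 1) n (by simp))
      (sec (m + 1) (n + 1) (by simp)) (cr' _ _ (by simp only; nlinarith))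
      (cr _ _ (by simp only; nlinarith))
      (cr _ _ (by simp only; nlinarith)) (norm_latticePoint_lt hv.re_pos ?_ ?_ ?_)
      (norm_latticePoint_lt hv.re_pos ?_ ?_ ?_) <;> simp

lemma exists_up_bound (hγ : 0 < γ) (hv : InSector γ v) (hvi : 0 < v.im) :
    ∃ K : ℝ, ∀ m n : ℕ,
      ‖latticePower γ v (m + 1, n) - latticePower γ v (m, n)‖ ^ 2 +
      ‖latticePower γ v (m, n + 1) - latticePower γ v (m, n)‖ ^ 2 ≤
      K * cross (latticePower γ v (m + 1, n) - latticePower γ v (m, n))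
        (latticePower γ v (m, n + 1) - latticePower γ v (m, n)) := by
  have e1 : ∀ m n : ℕ, latticePower γ v (m + 1, n) =
      (latticePoint v (id (m, n)) + 1) ^ (γ : ℂ) := by
    intro m n; simp only [latticePower, latticePoint, id]; congr 1; push_cast; ring
  have e2 : ∀ m n : ℕ, latticePower γ v (m, n + 1) =
      (latticePoint v (id (m, n)) + 1 * v) ^ (γ : ℂ) := by
    intro m n; simp only [latticePower, latticePoint, id]; congr 1; push_cast; ring
  obtain ⟨K, hK⟩ := exists_norm_sq_le_mul_cross γ hγ hv.re_pos hvi (id : ℕ × ℕ → ℕ × ℕ)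
    Function.injective_id (one_ne_zero) fun k => by
      have := (isLatticeSpread_latticePower hγ hv hvi).up k.1 k.2
      rw [e1 k.1 k.2, e2 k.1 k.2] at this
      exact this
  refine ⟨K, fun m n => ?_⟩
  rw [e1 m n, e2 m n]
  exact hK (m, n)

lemma exists_down_bound (hγ : 0 < γ) (hv : InSector γ v) (hvi : 0 < v.im) :
    ∃ K : ℝ, ∀ m n : ℕ,
      ‖latticePower γ v (m, n + 1) - latticePower γ v (m + 1, n + 1)‖ ^ 2 +
      ‖latticePower γ v (m + 1, n) - latticePower γ v (m + 1, n + 1)‖ ^ 2 ≤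
      K * cross (latticePower γ v (m, n + 1) - latticePower γ v (m + 1, n + 1))
        (latticePower γ v (m + 1, n) - latticePower γ v (m + 1, n + 1)) := by
  have e1 : ∀ m n : ℕ, latticePower γ v (m, n + 1) =
      (latticePoint v (m + 1, n + 1) + -1) ^ (γ : ℂ) := by
    intro m n; simp only [latticePower, latticePoint]; congr 1; push_cast; ring
  have e2 : ∀ m n : ℕ, latticePower γ v (m + 1, n) =
      (latticePoint v (m + 1, n + 1) + -1 * v) ^ (γ : ℂ) := by
    intro m n; simp only [latticePower, latticePoint]; congr 1; push_cast; ring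
  -- These cells are based at the vertex `(m + 1, n + 1)`, from which the edges are `-1` and `-v`;
  -- hence `ε = -1` and the shifted index.
  obtain ⟨K, hK⟩ := exists_norm_sq_le_mul_cross γ hγ hv.re_pos hvi
    (fun k : ℕ × ℕ => (k.1 + 1, k.2 + 1)) (fun k l h => by simpa [Prod.ext_iff] using h)
    (neg_ne_zero.2 one_ne_zero) fun k => by
      have := (isLatticeSpread_latticePower hγ hv hvi).down k.1 k.2
      rw [e1 k.1 k.2, e2 k.1 k.2] at this
      exact this
  refine ⟨K, fun m n => ?_⟩
  rw [e1 m n, e2 m n]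
  exact hK (m, n)

end LatticePower

end PowerMap

namespace PowerMap
open Filter Topology

/-! ### Injectivity of orientation-preserving piecewise affine maps -/

/-- A function on an interval that is covered by finitely many closed sets is strictly monotone if
it is strictly monotone on each of these sets. -/
lemma strictMonoOn_Icc_of_finite_closed_cover {ι : Type*} [Finite ι] {f : ℝ → ℝ} {a b : ℝ}
    {S : ι → Set ℝ} (hS : ∀ i, IsClosed (S i)) (hcov : Set.Icc a b ⊆ ⋃ i, S i)
    (hf : ∀ i, StrictMonoOn f (S i)) : StrictMonoOn f (Set.Icc a b) := by
  -- A closed set that misses `t` misses a neighbourhood of `t`. So near `t` every point shares a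
  -- piece with `t`, and comparisons with `f t` take place in one piece.
  have hloc : ∀ t : ℝ, ∃ ε > 0, ∀ t', |t' - t| < ε → ∀ i, t' ∈ S i → t ∈ S i := by
    intro t
    have : ∀ᶠ t' in 𝓝 t, ∀ i, t' ∈ S i → t ∈ S i := by
      rw [eventually_all]
      intro i
      by_cases ht : t ∈ S i
      · exact Eventually.of_forall fun _ _ => ht
      · filter_upwards [(hS i).isOpen_compl.mem_nhds ht] with t' h1 h2
        exact absurd h2 h1
    obtain ⟨ε, hε, h⟩ := Metric.eventually_nhds_iff.1 this
    exact ⟨ε, hε, fun t' ht' => h ht'⟩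
  intro x hx y hy hxy
  -- Continuous induction without continuity of `f`: the supremum of `E` belongs to `E` and, unless
  -- it is `y`, can be pushed to the right.
  set E := {t | t ∈ Set.Icc x y ∧ ∀ r ∈ Set.Ioc x t, f x < f r} with hE
  have hxE : x ∈ E := ⟨⟨le_rfl, hxy.le⟩, fun r hr => absurd (hr.1.trans_le hr.2) (lt_irrefl x)⟩
  have hbdd : BddAbove E := ⟨y, fun t ht => ht.1.2⟩
  set c := sSup E
  have hxc : x ≤ c := le_csSup hbdd hxE
  have hcy : c ≤ y := csSup_le ⟨x, hxE⟩ fun t ht => ht.1.2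
  obtain ⟨ε, hε, hc⟩ := hloc c
  have hmem : ∀ t, t ∈ Set.Icc x y → ∃ i, t ∈ S i := fun t ht =>
    Set.mem_iUnion.1 (hcov ⟨hx.1.trans ht.1, ht.2.trans hy.2⟩)
  have hcE : c ∈ E := by
    refine ⟨⟨hxc, hcy⟩, fun r hr => ?_⟩
    rcases hr.2.lt_or_eq with hrc | rfl
    · obtain ⟨e, heE, hre⟩ := exists_lt_of_lt_csSup ⟨x, hxE⟩ hrc
      exact heE.2 r ⟨hr.1, hre.le⟩
    · obtain ⟨e, heE, he⟩ := exists_lt_of_lt_csSup ⟨x, hxE⟩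
        (max_lt (sub_lt_self c hε) hr.1 : max (c - ε) x < c)
      have hec : e ≤ c := le_csSup hbdd heE
      have hxe : x < e := (le_max_right _ _).trans_lt he
      have hεe : c - ε < e := (le_max_left _ _).trans_lt he
      have h1 := heE.2 e ⟨hxe, le_rfl⟩
      rcases hec.lt_or_eq with hec' | hec'
      · obtain ⟨i, hi⟩ := hmem e heE.1
        exact h1.trans (hf i hi (hc e (by rw [abs_lt]; constructor <;> linarith) i hi) hec')
      · rwa [hec'] at h1
  have hfc : f x ≤ f c := by
    rcases hxc.lt_or_eq with h | h
    · exact (hcE.2 c ⟨h, le_rfl⟩).le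
    · rw [h]
  have hcy' : c = y := by
    by_contra hne
    have hlt : c < y := lt_of_le_of_ne hcy hne
    have ht : min (c + ε / 2) y ∈ E := by
      refine ⟨⟨le_min (by linarith) hxy.le, min_le_right _ _⟩, fun r hr => ?_⟩
      rcases le_or_gt r c with hrc | hrc
      · exact hcE.2 r ⟨hr.1, hrc⟩
      · have h1 : r ≤ c + ε / 2 := hr.2.trans (min_le_left _ _)
        obtain ⟨i, hi⟩ := hmem r ⟨hr.1.le, hr.2.trans (min_le_right _ _)⟩
        exact hfc.trans_lt (hf i (hc r (by rw [abs_lt]; constructor <;> linarith) i hi) hi hrc)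
    have := le_csSup hbdd ht
    have : c < min (c + ε / 2) y := lt_min (by linarith) hlt
    linarith
  rw [← hcy'] at hxy ⊢
  exact hcE.2 c ⟨hxy, le_rfl⟩

lemma continuousOn_of_finite_closed_cover {ι X Y : Type*} [Finite ι] [TopologicalSpace X]
    [TopologicalSpace Y] {f : X → Y} {s : Set X} {C : ι → Set X} (hC : ∀ i, IsClosed (C i))
    (hs : s ⊆ ⋃ i, C i) (hf : ∀ i, ContinuousOn f (C i)) : ContinuousOn f s :=
  ((locallyFinite_of_finite C).continuousOn_iUnion hC hf).mono hs

lemma cross_smul_left (r : ℝ) (a b : ℂ) : cross (r • a) b = r * cross a b := by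
  simp only [cross, Complex.smul_re, Complex.smul_im, smul_eq_mul]; ring

lemma cross_smul_right (r : ℝ) (a b : ℂ) : cross a (r • b) = r * cross a b := by
  simp only [cross, Complex.smul_re, Complex.smul_im, smul_eq_mul]; ring

lemma cross_add_left (a b c : ℂ) : cross (a + b) c = cross a c + cross b c := by
  simp only [cross, Complex.add_re, Complex.add_im]; ring

lemma cross_add_right (a b c : ℂ) : cross a (b + c) = cross a b + cross a c := by
  simp only [cross, Complex.add_re, Complex.add_im]; ring

lemma cross_sub_right (a b c : ℂ) : cross a (b - c) = cross a b - cross a c := by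
  simp only [cross, Complex.sub_re, Complex.sub_im]; ring

lemma cross_self (a : ℂ) : cross a a = 0 := by
  simp only [cross]; ring

lemma cross_comm (a b : ℂ) : cross a b = - cross b a := by
  simp only [cross]; ring

@[fun_prop]
lemma continuous_cross_right (a : ℂ) : Continuous (cross a) := by
  unfold cross; fun_prop

lemma im_div_re_lt_iff {z w : ℂ} (hz : 0 < z.re) (hw : 0 < w.re) :
    z.im / z.re < w.im / w.re ↔ 0 < cross z w := by
  rw [div_lt_div_iff₀ hz hw, cross]
  constructor <;> intro h <;> linarith

/-- A piecewise affine map from the triangle `x, y ≥ 0`, `x + y ≤ N` to the right half plane. It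
preserves the orientation, and along the lines `x + y = s` the argument increases from its value at
`(s, 0)`, the least one, to its value at `(0, s)`, the greatest one. -/
structure IsSpread {ι : Type*} (N : ℝ) (G : ℝ × ℝ → ℂ) (C : ι → Set (ℝ × ℝ)) (a b : ι → ℂ) :
    Prop where
  isCompact : ∀ i, IsCompact (C i)
  nonneg : ∀ i, ∀ z ∈ C i, 0 ≤ z.1 ∧ 0 ≤ z.2
  cover : ∀ z : ℝ × ℝ, 0 ≤ z.1 → 0 ≤ z.2 → z.1 + z.2 ≤ N → ∃ i, z ∈ C i
  affine : ∀ i, ∀ z ∈ C i, ∀ w ∈ C i, G w = G z + ((w.1 - z.1) • a i + (w.2 - z.2) • b i)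
  det_pos : ∀ i, 0 < cross (a i) (b i)
  map_zero : G 0 = 0
  re_pos : ∀ i, ∀ z ∈ C i, z ≠ 0 → 0 < (G z).re
  row_pos : ∀ i, ∀ z ∈ C i, z ≠ 0 → 0 < cross (G z) (b i - a i)
  left : ∀ s, 0 ≤ s → ∀ z : ℝ × ℝ, 0 ≤ z.1 → 0 ≤ z.2 → 0 ≤ cross (G (s, 0)) (G z)
  right : ∀ s, 0 ≤ s → ∀ z : ℝ × ℝ, 0 ≤ z.1 → 0 ≤ z.2 → 0 ≤ cross (G z) (G (0, s))

namespace IsSpread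

variable {ι : Type*} {N : ℝ} {G : ℝ × ℝ → ℂ} {C : ι → Set (ℝ × ℝ)} {a b : ι → ℂ}

lemma continuousOn_piece (h : IsSpread N G C a b) (i : ι) : ContinuousOn G (C i) := by
  rcases (C i).eq_empty_or_nonempty with he | ⟨z, hz⟩
  · rw [he]; exact continuousOn_empty G
  · have : Continuous fun w : ℝ × ℝ => G z + ((w.1 - z.1) • a i + (w.2 - z.2) • b i) := by
      fun_prop
    exact this.continuousOn.congr fun w hw => h.affine i z hz w hw

lemma continuousOn [Finite ι] (h : IsSpread N G C a b) :
    ContinuousOn G {z | 0 ≤ z.1 ∧ 0 ≤ z.2 ∧ z.1 + z.2 ≤ N} :=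
  continuousOn_of_finite_closed_cover (fun i => (h.isCompact i).isClosed)
    (fun z hz => Set.mem_iUnion.2 (h.cover z hz.1 hz.2.1 hz.2.2)) h.continuousOn_piece

/-- The slope `im / re` stands for the argument. On one piece the row direction is mapped to `b i -
a i`, which by `row_pos` turns counterclockwise relative to `G z`. -/
lemma strictMonoOn_row [Finite ι] (h : IsSpread N G C a b) {s : ℝ} (hs : 0 < s) (hsN : s ≤ N) :
    StrictMonoOn (fun t => (G (s - t, t)).im / (G (s - t, t)).re) (Set.Icc 0 s) := by
  have hne : ∀ t : ℝ, ((s - t, t) : ℝ × ℝ) ≠ 0 := by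
    intro t h0
    rw [Prod.mk_eq_zero] at h0
    linarith [h0.1, h0.2]
  refine strictMonoOn_Icc_of_finite_closed_cover
    (S := fun i => (fun t : ℝ => ((s - t, t) : ℝ × ℝ)) ⁻¹' C i)
    (fun i => (h.isCompact i).isClosed.preimage (by fun_prop)) ?_ ?_
  · intro t ht
    exact Set.mem_iUnion.2 (h.cover (s - t, t) (by simpa using ht.2) ht.1 (by simpa using hsN))
  · intro i t ht t' ht' htt
    have ht : (s - t, t) ∈ C i := ht
    have ht' : (s - t', t') ∈ C i := ht'
    simp only
    rw [im_div_re_lt_iff (h.re_pos i _ ht (hne t)) (h.re_pos i _ ht' (hne t'))]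
    have e : G (s - t', t') = G (s - t, t) + (t' - t) • (b i - a i) := by
      rw [h.affine i _ ht _ ht']
      congr 1
      simp only [smul_sub]
      rw [show s - t' - (s - t) = -(t' - t) by ring, neg_smul]
      ring
    rw [e, cross_add_right, cross_self, cross_smul_right, zero_add]
    exact mul_pos (sub_pos.2 htt) (h.row_pos i _ ht (hne t))

/-- Along a level line of the argument, the modulus increases with `x + y`. -/
lemma re_lt_re_of_cross_eq_zero (h : IsSpread N G C a b) {d : ℂ} (hd : 0 < d.re) {i : ι}
    {z w : ℝ × ℝ} (hz : z ∈ C i) (hw : w ∈ C i) (hz0 : z ≠ 0) (hdz : cross d (G z) = 0)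
    (hdw : cross d (G w) = 0) (hzw : z.1 + z.2 < w.1 + w.2) : (G z).re < (G w).re := by
  have hdet := h.det_pos i
  have hrow := h.row_pos i z hz hz0
  have hre := h.re_pos i z hz hz0
  have haff := h.affine i z hz w hw
  set α := w.1 - z.1
  set β := w.2 - z.2
  have hαβ : 0 < α + β := by simp only [α, β]; linarith
  rw [haff] at hdw
  have e1 : cross (α • a i + β • b i) (b i - a i) = (α + β) * cross (a i) (b i) := by
    simp only [cross, Complex.add_re, Complex.add_im, Complex.sub_re, Complex.sub_im,
      Complex.smul_re, Complex.smul_im, smul_eq_mul]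
    ring
  have h1 : 0 < cross (α • a i + β • b i) (b i - a i) := by rw [e1]; positivity
  rw [haff, Complex.add_re]
  set L := α • a i + β • b i
  rw [cross_add_right, hdz, zero_add] at hdw
  simp only [cross] at hdz hdw h1 hrow
  -- `G z` and the increment `L` are both real multiples of `d`. Their cross products with `b i - a
  -- i` are both positive, so they are positive multiples of one another and `L.re > 0`.
  have hgi : (G z).im = d.im * (G z).re / d.re := by field_simp; linarith
  have hLi : L.im = d.im * L.re / d.re := by field_simp; linarith
  rw [hgi] at hrow
  rw [hLi] at h1
  have e2 : (G z).re * (L.re * (b i - a i).im - d.im * L.re / d.re * (b i - a i).re) =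
      L.re * ((G z).re * (b i - a i).im - d.im * (G z).re / d.re * (b i - a i).re) := by ring
  have h2 : 0 < L.re * ((G z).re * (b i - a i).im - d.im * (G z).re / d.re * (b i - a i).re) := by
    rw [← e2]; positivity
  have := pos_of_mul_pos_left h2 hrow.le
  linarith

/-- Two points on one row have different slopes by `strictMonoOn_row`. If points of different rows
had equal images, the level line of the argument through the lower one would meet every row up to
the other in exactly one point and end at the other. The real part increases strictly along it, a
contradiction. -/
theorem injOn [Finite ι] (h : IsSpread N G C a b) :
    Set.InjOn G {z | 0 ≤ z.1 ∧ 0 ≤ z.2 ∧ z.1 + z.2 ≤ N} := by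
  have hre : ∀ z : ℝ × ℝ, 0 ≤ z.1 → 0 ≤ z.2 → z.1 + z.2 ≤ N → z ≠ 0 → 0 < (G z).re := by
    intro z h1 h2 h3 h0
    obtain ⟨i, hi⟩ := h.cover z h1 h2 h3
    exact h.re_pos i z hi h0
  have hsum : ∀ z : ℝ × ℝ, 0 ≤ z.1 → 0 ≤ z.2 → z ≠ 0 → 0 < z.1 + z.2 := by
    intro z h1 h2 h0
    refine lt_of_le_of_ne (by linarith) fun he => h0 ?_
    exact Prod.ext (by simp; linarith) (by simp; linarith)
  have huniq : ∀ z w : ℝ × ℝ, 0 ≤ z.1 → 0 ≤ z.2 → 0 ≤ w.1 → 0 ≤ w.2 → z.1 + z.2 ≤ N →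
      0 < z.1 + z.2 → z.1 + z.2 = w.1 + w.2 → cross (G z) (G w) = 0 → z = w := by
    intro z w hz1 hz2 hw1 hw2 hN h0 hs hc
    have hz0 : z ≠ 0 := by rintro rfl; simp at h0
    have hw0 : w ≠ 0 := by rintro rfl; rw [hs] at h0; simp at h0
    have hmono := h.strictMonoOn_row h0 hN
    have ez : z = (z.1 + z.2 - z.2, z.2) := by ext <;> simp
    have ew : w = (z.1 + z.2 - w.2, w.2) := by ext <;> simp [hs]
    have hzr := hre z hz1 hz2 hN hz0
    have hwr := hre w hw1 hw2 (hs ▸ hN) hw0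
    have e : (G z).im / (G z).re = (G w).im / (G w).re := by
      simp only [cross] at hc
      rw [div_eq_div_iff hzr.ne' hwr.ne']; linarith
    have : z.2 = w.2 :=
      hmono.injOn ⟨hz2, by linarith⟩ ⟨hw2, by linarith⟩ (by simpa only [← ez, ← ew] using e)
    exact Prod.ext (by linarith) this
  have hlt : ∀ z w : ℝ × ℝ, 0 ≤ z.1 → 0 ≤ z.2 → 0 ≤ w.1 → 0 ≤ w.2 → w.1 + w.2 ≤ N → z ≠ 0 →
      z.1 + z.2 < w.1 + w.2 → G z ≠ G w := by
    intro z w hz1 hz2 hw1 hw2 hN hz0 hs heq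
    have hz0' := hsum z hz1 hz2 hz0
    have hd := hre z hz1 hz2 (by linarith) hz0
    -- the point of the level line of the argument on each row
    have hex : ∀ s ∈ Set.Icc (z.1 + z.2) (w.1 + w.2), ∃ x : ℝ × ℝ, 0 ≤ x.1 ∧ 0 ≤ x.2 ∧
        x.1 + x.2 = s ∧ cross (G z) (G x) = 0 := by
      intro s hs
      have hs0 : 0 ≤ s := by linarith [hs.1]
      have hc : ContinuousOn (fun t => cross (G z) (G (s - t, t))) (Set.Icc 0 s) := by
        refine (continuous_cross_right (G z)).comp_continuousOn
          (h.continuousOn.comp (by fun_prop) fun t ht => ?_)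
        exact ⟨by simpa using ht.2, ht.1, by simpa using hs.2.trans hN⟩
      have := intermediate_value_Icc hs0 hc
      obtain ⟨t, ht, ht0⟩ := this (show (0 : ℝ) ∈ Set.Icc _ _ from
        ⟨by
          have := h.left s hs0 z hz1 hz2
          rw [cross_comm] at this
          simpa using this, by simpa using h.right s hs0 z hz1 hz2⟩)
      exact ⟨(s - t, t), by simpa using ht.2, ht.1, by simp, ht0⟩
    choose! σ hσ1 hσ2 hσ3 hσ4 using hex
    have hσz : σ (z.1 + z.2) = z := by
      have hm : z.1 + z.2 ∈ Set.Icc (z.1 + z.2) (w.1 + w.2) := ⟨le_rfl, hs.le⟩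
      exact (huniq _ _ hz1 hz2 (hσ1 _ hm) (hσ2 _ hm) (by linarith) hz0' (hσ3 _ hm).symm
        (hσ4 _ hm)).symm
    have hσw : σ (w.1 + w.2) = w := by
      have hm : w.1 + w.2 ∈ Set.Icc (z.1 + z.2) (w.1 + w.2) := ⟨hs.le, le_rfl⟩
      refine (huniq _ _ hw1 hw2 (hσ1 _ hm) (hσ2 _ hm) hN (by linarith) (hσ3 _ hm).symm
        ?_).symm
      rw [← heq]
      exact hσ4 _ hm
    -- The parameters `s` with `σ s ∈ C i` form the projection of a compact set, hence a closed one.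
    -- This gives the finite closed cover without proving that `σ` is continuous.
    have hmono : StrictMonoOn (fun s => (G (σ s)).re) (Set.Icc (z.1 + z.2) (w.1 + w.2)) := by
      set D := {x : ℝ × ℝ | z.1 + z.2 ≤ x.1 + x.2 ∧ x.1 + x.2 ≤ w.1 + w.2}
      have hD : IsClosed D := isClosed_Icc.preimage
        (continuous_fst.add continuous_snd : Continuous fun x : ℝ × ℝ => x.1 + x.2)
      have key : ∀ i, ∀ s ∈ (fun x : ℝ × ℝ => x.1 + x.2) ''
          ((C i ∩ {x | cross (G z) (G x) = 0}) ∩ D),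
          s ∈ Set.Icc (z.1 + z.2) (w.1 + w.2) ∧ σ s ∈ C i := by
        rintro i s ⟨x, ⟨⟨hxC, hx0⟩, hxD⟩, rfl⟩
        refine ⟨hxD, ?_⟩
        have hx12 := h.nonneg i x hxC
        have hxN : x.1 + x.2 ≤ N := hxD.2.trans hN
        have hx00 : 0 < x.1 + x.2 := hz0'.trans_le hxD.1
        have hx : x ≠ 0 := by rintro rfl; simp at hx00
        have hσx : σ (x.1 + x.2) = x := by
          refine (huniq x _ hx12.1 hx12.2 (hσ1 _ hxD) (hσ2 _ hxD) hxN hx00 (hσ3 _ hxD).symm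
            ?_).symm
          have e1 := hx0
          have e2 := hσ4 _ hxD
          simp only [cross, Set.mem_ofPred_eq] at e1 e2 ⊢
          have f1 : (G x).im = (G z).im * (G x).re / (G z).re := by field_simp; linarith
          have f2 : (G (σ (x.1 + x.2))).im =
            (G z).im * (G (σ (x.1 + x.2))).re / (G z).re := by field_simp; linarith
          rw [f1, f2]
          ring
        rw [hσx]
        exact hxC
      refine strictMonoOn_Icc_of_finite_closed_cover
        (S := fun i => (fun x : ℝ × ℝ => x.1 + x.2) ''
          ((C i ∩ {x | cross (G z) (G x) = 0}) ∩ D)) ?_ ?_ ?_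
      · intro i
        have hcl : IsClosed (C i ∩ {x | cross (G z) (G x) = 0}) :=
          ((continuous_cross_right (G z)).comp_continuousOn
            (h.continuousOn_piece i)).preimage_isClosed_of_isClosed (h.isCompact i).isClosed
            isClosed_singleton
        exact (((h.isCompact i).of_isClosed_subset hcl Set.inter_subset_left).inter_right
          hD).image (by fun_prop) |>.isClosed
      · intro s hs
        obtain ⟨i, hi⟩ := h.cover (σ s) (hσ1 s hs) (hσ2 s hs) ((hσ3 s hs).trans_le (hs.2.trans hN))
        refine Set.mem_iUnion.2 ⟨i, σ s, ⟨⟨hi, hσ4 s hs⟩, ?_⟩, hσ3 s hs⟩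
        simp only [D, Set.mem_ofPred_eq, hσ3 s hs]
        exact hs
      · intro i s hs t ht hst
        obtain ⟨hs1, hs2⟩ := key i s hs
        obtain ⟨ht1, ht2⟩ := key i t ht
        refine h.re_lt_re_of_cross_eq_zero hd hs2 ht2 ?_ (hσ4 s hs1) (hσ4 t ht1)
          (by rw [hσ3 s hs1, hσ3 t ht1]; exact hst)
        intro h0
        have := hσ3 s hs1
        rw [h0] at this
        simp at this
        linarith [hs1.1]
    have := hmono ⟨le_rfl, hs.le⟩ ⟨hs.le, le_rfl⟩ hs
    simp only [hσz, hσw, heq] at this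
    exact lt_irrefl _ this
  intro z hz w hw heq
  by_cases hz0 : z = 0
  · by_contra hne
    subst hz0
    have := hre w hw.1 hw.2.1 hw.2.2 (Ne.symm hne)
    rw [← heq, h.map_zero] at this
    simp at this
  by_cases hw0 : w = 0
  · subst hw0
    have := hre z hz.1 hz.2.1 hz.2.2 hz0
    rw [heq, h.map_zero] at this
    simp at this
  rcases lt_trichotomy (z.1 + z.2) (w.1 + w.2) with hs | hs | hs
  · exact absurd heq (hlt z w hz.1 hz.2.1 hw.1 hw.2.1 hw.2.2 hz0 hs)
  · exact huniq z w hz.1 hz.2.1 hw.1 hw.2.1 hz.2.2 (hsum z hz.1 hz.2.1 hz0) hs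
      (by rw [heq, cross_self])
  · exact absurd heq.symm (hlt w z hw.1 hw.2.1 hz.1 hz.2.1 hz.2.2 hw0 hs)

end IsSpread

end PowerMap

namespace PowerMap
open Filter Topology

/-! ### The piecewise affine extension of lattice data -/

/-- The unit lattice triangle with vertices `(m, n)`, `(m + 1, n)`, `(m, n + 1)`. -/
def upCell (m n : ℕ) : Set (ℝ × ℝ) := {z | m ≤ z.1 ∧ n ≤ z.2 ∧ z.1 + z.2 ≤ m + n + 1}

/-- The unit lattice triangle with vertices `(m + 1, n + 1)`, `(m, n + 1)`, `(m + 1, n)`. -/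
def downCell (m n : ℕ) : Set (ℝ × ℝ) :=
  {z | z.1 ≤ m + 1 ∧ z.2 ≤ n + 1 ∧ m + n + 1 ≤ z.1 + z.2}

/-- The affine interpolation of `H` at the vertices of `upCell m n`. -/
noncomputable def upMap (H : ℕ → ℕ → ℂ) (m n : ℕ) (z : ℝ × ℝ) : ℂ :=
  H m n + (z.1 - m) • (H (m + 1) n - H m n) + (z.2 - n) • (H m (n + 1) - H m n)

/-- The affine interpolation of `H` at the vertices of `downCell m n`. -/
noncomputable def downMap (H : ℕ → ℕ → ℂ) (m n : ℕ) (z : ℝ × ℝ) : ℂ :=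
  H (m + 1) (n + 1) + (m + 1 - z.1) • (H m (n + 1) - H (m + 1) (n + 1)) +
    (n + 1 - z.2) • (H (m + 1) n - H (m + 1) (n + 1))

/-- The piecewise affine extension of a function on the lattice quadrant. -/
noncomputable def plExtension (H : ℕ → ℕ → ℂ) (z : ℝ × ℝ) : ℂ :=
  if z.1 + z.2 ≤ ⌊z.1⌋₊ + ⌊z.2⌋₊ + 1 then upMap H ⌊z.1⌋₊ ⌊z.2⌋₊ z else downMap H ⌊z.1⌋₊ ⌊z.2⌋₊ z

variable {H : ℕ → ℕ → ℂ}

lemma upMap_eq_downMap {m n : ℕ} {z : ℝ × ℝ} (h : z.1 + z.2 = m + n + 1) :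
    upMap H m n z = downMap H m n z := by
  have : z.2 = m + n + 1 - z.1 := by linarith
  simp only [upMap, downMap, this, Complex.real_smul]
  push_cast
  ring

lemma plExtension_of_floor {m n : ℕ} {z : ℝ × ℝ} (h1 : (m : ℝ) ≤ z.1) (h1' : z.1 < m + 1)
    (h2 : (n : ℝ) ≤ z.2) (h2' : z.2 < n + 1) :
    plExtension H z = if z.1 + z.2 ≤ m + n + 1 then upMap H m n z else downMap H m n z := by
  have e1 : ⌊z.1⌋₊ = m := (Nat.floor_eq_iff (by linarith [(Nat.cast_nonneg m : (0 : ℝ) ≤ m)])).2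
    ⟨h1, h1'⟩
  have e2 : ⌊z.2⌋₊ = n := (Nat.floor_eq_iff (by linarith [(Nat.cast_nonneg n : (0 : ℝ) ≤ n)])).2
    ⟨h2, h2'⟩
  rw [plExtension, e1, e2]

/-- The floors are `(m, n)` except at the vertices `(m + 1, n)` and `(m, n + 1)`, where the
neighbouring cell gives the same value. -/
lemma plExtension_of_mem_upCell {m n : ℕ} {z : ℝ × ℝ} (hz : z ∈ upCell m n) :
    plExtension H z = upMap H m n z := by
  obtain ⟨h1, h2, h3⟩ := hz
  rcases (show z.1 ≤ m + 1 by linarith).lt_or_eq with h1' | h1'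
  · rcases (show z.2 ≤ n + 1 by linarith).lt_or_eq with h2' | h2'
    · rw [plExtension_of_floor h1 h1' h2 h2', if_pos h3]
    · have h1'' : z.1 = m := by linarith
      rw [plExtension_of_floor (m := m) (n := n + 1) (by linarith) (by linarith)
        (by push_cast; linarith) (by push_cast; linarith), if_pos (by push_cast; linarith)]
      simp [upMap, h1'', h2']
  · have h2'' : z.2 = n := by linarith
    rw [plExtension_of_floor (m := m + 1) (n := n) (by push_cast; linarith)
      (by push_cast; linarith) (by linarith) (by linarith), if_pos (by push_cast; linarith)]
    simp [upMap, h1', h2'']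

/-- The right and top edges have floors in a neighbouring cell; they are edges of up cells, on which
both formulas agree. -/
lemma plExtension_of_mem_downCell {m n : ℕ} {z : ℝ × ℝ} (hz : z ∈ downCell m n) :
    plExtension H z = downMap H m n z := by
  obtain ⟨h1, h2, h3⟩ := hz
  rcases h1.lt_or_eq with h1' | h1'
  · rcases h2.lt_or_eq with h2' | h2'
    · rw [plExtension_of_floor (by linarith) h1' (by linarith) h2']
      split_ifs with h
      · exact upMap_eq_downMap (le_antisymm h h3)
      · rfl
    · rw [plExtension_of_mem_upCell (m := m) (n := n + 1)
        ⟨by linarith, by push_cast; linarith, by push_cast; linarith⟩]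
      simp only [upMap, downMap, h2', Complex.real_smul]
      push_cast
      ring
  · rw [plExtension_of_mem_upCell (m := m + 1) (n := n)
      ⟨by push_cast; linarith, by linarith, by push_cast; linarith⟩]
    simp only [upMap, downMap, h1', Complex.real_smul]
    push_cast
    ring

lemma plExtension_natCast (m n : ℕ) : plExtension H (m, n) = H m n := by
  rw [plExtension_of_mem_upCell (m := m) (n := n) ⟨le_rfl, le_rfl, by simp⟩]
  simp [upMap]

/-- The strict inequality in the second case keeps the chosen down cell inside `x + y ≤ N` when `N`
is a natural number and `z` lies in that triangle. -/
lemma exists_mem_cell {z : ℝ × ℝ} (h1 : 0 ≤ z.1) (h2 : 0 ≤ z.2) :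
    ∃ m n : ℕ, (m : ℝ) ≤ z.1 ∧ (n : ℝ) ≤ z.2 ∧
      (z ∈ upCell m n ∨ z ∈ downCell m n ∧ (m + n + 1 : ℝ) < z.1 + z.2) := by
  refine ⟨⌊z.1⌋₊, ⌊z.2⌋₊, Nat.floor_le h1, Nat.floor_le h2, ?_⟩
  rcases le_or_gt (z.1 + z.2) (⌊z.1⌋₊ + ⌊z.2⌋₊ + 1) with h | h
  · exact Or.inl ⟨Nat.floor_le h1, Nat.floor_le h2, h⟩
  · exact Or.inr ⟨⟨(Nat.lt_floor_add_one _).le, (Nat.lt_floor_add_one _).le, h.le⟩, h⟩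

/-- On each cell the piecewise affine extension is a convex combination of the values at the
vertices. -/
lemma plExtension_eq_of_mem_upCell {m n : ℕ} {z : ℝ × ℝ} (hz : z ∈ upCell m n) :
    plExtension H z = (m + n + 1 - z.1 - z.2) • H m n + (z.1 - m) • H (m + 1) n +
      (z.2 - n) • H m (n + 1) := by
  rw [plExtension_of_mem_upCell hz]
  simp only [upMap, Complex.real_smul]
  push_cast
  ring

lemma plExtension_eq_of_mem_downCell {m n : ℕ} {z : ℝ × ℝ} (hz : z ∈ downCell m n) :
    plExtension H z = (z.1 + z.2 - m - n - 1) • H (m + 1) (n + 1) +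
      (m + 1 - z.1) • H m (n + 1) + (n + 1 - z.2) • H (m + 1) n := by
  rw [plExtension_of_mem_downCell hz]
  simp only [downMap, Complex.real_smul]
  push_cast
  ring

lemma cross_plExtension_nonneg {w : ℂ} (hw : ∀ m n, 0 ≤ cross w (H m n)) {z : ℝ × ℝ}
    (h1 : 0 ≤ z.1) (h2 : 0 ≤ z.2) : 0 ≤ cross w (plExtension H z) := by
  obtain ⟨m, n, -, -, hz | ⟨hz, -⟩⟩ := exists_mem_cell h1 h2
  · rw [plExtension_eq_of_mem_upCell hz]
    obtain ⟨h1, h2, h3⟩ := hz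
    simp only [cross_add_right, cross_smul_right]
    have := mul_nonneg (by linarith : 0 ≤ (m + n + 1 - z.1 - z.2)) (hw m n)
    have := mul_nonneg (by linarith : 0 ≤ z.1 - m) (hw (m + 1) n)
    have := mul_nonneg (by linarith : 0 ≤ z.2 - n) (hw m (n + 1))
    linarith
  · rw [plExtension_eq_of_mem_downCell hz]
    obtain ⟨h1, h2, h3⟩ := hz
    simp only [cross_add_right, cross_smul_right]
    have := mul_nonneg (by linarith : 0 ≤ (z.1 + z.2 - m - n - 1)) (hw (m + 1) (n + 1))
    have := mul_nonneg (by linarith : 0 ≤ m + 1 - z.1) (hw m (n + 1))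
    have := mul_nonneg (by linarith : 0 ≤ n + 1 - z.2) (hw (m + 1) n)
    linarith

/-- A real-linear functional that is positive at the nonzero vertices of a cell is positive at the
nonzero points of the cell. -/
lemma pos_plExtension_of_mem_upCell (φ : ℂ →ₗ[ℝ] ℝ) {m n : ℕ} {z : ℝ × ℝ} (hz : z ∈ upCell m n)
    (hz0 : z ≠ 0) (H0 : H 0 0 = 0) (h0 : m ≠ 0 ∨ n ≠ 0 → 0 < φ (H m n))
    (h1 : 0 < φ (H (m + 1) n)) (h2 : 0 < φ (H m (n + 1))) : 0 < φ (plExtension H z) := by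
  rw [plExtension_eq_of_mem_upCell hz]
  obtain ⟨l1, l2, l3⟩ := hz
  simp only [map_add, map_smul, smul_eq_mul]
  have p1 : 0 ≤ z.1 - m := by linarith
  have p2 : 0 ≤ z.2 - n := by linarith
  have p3 : 0 ≤ m + n + 1 - z.1 - z.2 := by linarith
  by_cases hmn : m ≠ 0 ∨ n ≠ 0
  · have h0 := h0 hmn
    rcases p1.lt_or_eq with q1 | q1
    · positivity
    rcases p2.lt_or_eq with q2 | q2
    · positivity
    have : 0 < m + n + 1 - z.1 - z.2 := by linarith
    positivity
  · push Not at hmn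
    obtain ⟨rfl, rfl⟩ := hmn
    rw [H0, map_zero, mul_zero, zero_add]
    rcases p1.lt_or_eq with q1 | q1
    · positivity
    rcases p2.lt_or_eq with q2 | q2
    · positivity
    exact absurd (Prod.ext (by simpa using (sub_eq_zero.1 q1.symm))
      (by simpa using (sub_eq_zero.1 q2.symm))) hz0

lemma pos_plExtension_of_mem_downCell (φ : ℂ →ₗ[ℝ] ℝ) {m n : ℕ} {z : ℝ × ℝ}
    (hz : z ∈ downCell m n) (h0 : 0 < φ (H (m + 1) (n + 1)))
    (h1 : 0 < φ (H m (n + 1))) (h2 : 0 < φ (H (m + 1) n)) : 0 < φ (plExtension H z) := by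
  rw [plExtension_eq_of_mem_downCell hz]
  obtain ⟨l1, l2, l3⟩ := hz
  simp only [map_add, map_smul, smul_eq_mul]
  have p1 : 0 ≤ m + 1 - z.1 := by linarith
  have p2 : 0 ≤ n + 1 - z.2 := by linarith
  have p3 : 0 ≤ z.1 + z.2 - m - n - 1 := by linarith
  rcases p1.lt_or_eq with q1 | q1
  · positivity
  rcases p2.lt_or_eq with q2 | q2
  · positivity
  have : 0 < z.1 + z.2 - m - n - 1 := by linarith
  positivity

/-- The cross product with a fixed vector on the right. -/
noncomputable def crossLeft (w : ℂ) : ℂ →ₗ[ℝ] ℝ where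
  toFun a := cross a w
  map_add' a b := cross_add_left a b w
  map_smul' r a := cross_smul_left r a w

/-- The cells of the subdivision of the triangle `x, y ≥ 0`, `x + y ≤ N`. -/
abbrev CellIndex (N : ℕ) : Type :=
  {k : ℕ × ℕ // k.1 + k.2 + 1 ≤ N} ⊕ {k : ℕ × ℕ // k.1 + k.2 + 2 ≤ N}

instance finite_cellIndex (N : ℕ) : Finite (CellIndex N) := by
  have : ∀ c : ℕ, Finite {k : ℕ × ℕ // k.1 + k.2 + c ≤ N} := fun c =>
    Set.Finite.to_subtype (((Set.finite_Iic N).prod (Set.finite_Iic N)).subset fun k hk => by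
      have hk : k.1 + k.2 + c ≤ N := hk
      exact ⟨Set.mem_Iic.2 (by omega), Set.mem_Iic.2 (by omega)⟩)
  have h1 := this 1
  have h2 := this 2
  exact inferInstanceAs (Finite (_ ⊕ _))

lemma isCompact_upCell (m n : ℕ) : IsCompact (upCell m n) := by
  refine (isCompact_Icc (a := ((m : ℝ), (n : ℝ)))
    (b := ((m : ℝ) + 1, (n : ℝ) + 1))).of_isClosed_subset ?_ fun z hz => ?_
  · exact (isClosed_le continuous_const continuous_fst).inter
      ((isClosed_le continuous_const continuous_snd).inter
      (isClosed_le (continuous_fst.add continuous_snd) continuous_const))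
  · obtain ⟨h1, h2, h3⟩ := hz
    exact ⟨⟨h1, h2⟩, ⟨by simp only; linarith, by simp only; linarith⟩⟩

lemma isCompact_downCell (m n : ℕ) : IsCompact (downCell m n) := by
  refine (isCompact_Icc (a := ((m : ℝ), (n : ℝ)))
    (b := ((m : ℝ) + 1, (n : ℝ) + 1))).of_isClosed_subset ?_ fun z hz => ?_
  · exact (isClosed_le continuous_fst continuous_const).inter
      ((isClosed_le continuous_snd continuous_const).inter
      (isClosed_le continuous_const (continuous_fst.add continuous_snd)))
  · obtain ⟨h1, h2, h3⟩ := hz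
    exact ⟨⟨by simp only; linarith, by simp only; linarith⟩, ⟨h1, h2⟩⟩

/-- `G` is a convex combination of vertex values on each cell, so every sign condition on a linear
functional of `G` need only be checked at vertices, where it is one of the lattice inequalities. -/
theorem IsLatticeSpread.isSpread (hH : IsLatticeSpread H) {N : ℕ} (hN1 : 1 ≤ N) :
    IsSpread (ι := CellIndex N) N (plExtension H)
      (Sum.elim (fun k => upCell k.1.1 k.1.2) (fun k => downCell k.1.1 k.1.2))
      (Sum.elim (fun k => H (k.1.1 + 1) k.1.2 - H k.1.1 k.1.2)
        (fun k => H (k.1.1 + 1) (k.1.2 + 1) - H k.1.1 (k.1.2 + 1)))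
      (Sum.elim (fun k => H k.1.1 (k.1.2 + 1) - H k.1.1 k.1.2)
        (fun k => H (k.1.1 + 1) (k.1.2 + 1) - H (k.1.1 + 1) k.1.2)) where
  isCompact := by
    rintro (⟨⟨m, n⟩, h⟩ | ⟨⟨m, n⟩, h⟩)
    · exact isCompact_upCell m n
    · exact isCompact_downCell m n
  nonneg := by
    rintro (⟨⟨m, n⟩, h⟩ | ⟨⟨m, n⟩, h⟩) z ⟨h1, h2, h3⟩
    all_goals
      have hm : (0 : ℝ) ≤ m := m.cast_nonneg
      have hn : (0 : ℝ) ≤ n := n.cast_nonneg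
      simp only at h1 h2 h3
      constructor <;> linarith
  cover := by
    intro z h1 h2 h3
    obtain ⟨m, n, hm, hn, hz | ⟨hz, hlt⟩⟩ := exists_mem_cell h1 h2
    · have hmn : (m + n : ℝ) ≤ N := by linarith
      have hmn : m + n ≤ N := by exact_mod_cast hmn
      rcases hmn.lt_or_eq with hlt | heq
      · exact ⟨Sum.inl ⟨(m, n), hlt⟩, hz⟩
      -- Here `z` is a lattice point on the hypotenuse, so its own up cell leaves the triangle; the
      -- cell below it or to its left is used. This needs `1 ≤ N`.
      · have hN : (m + n : ℝ) = N := by exact_mod_cast heq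
        have e1 : z.1 = m := by linarith
        have e2 : z.2 = n := by linarith
        rcases Nat.eq_zero_or_pos m with rfl | hm0
        · rcases Nat.eq_zero_or_pos n with rfl | hn0
          · omega
          · obtain ⟨n, rfl⟩ := Nat.exists_eq_succ_of_ne_zero hn0.ne'
            exact ⟨Sum.inl ⟨(0, n), by simp only; omega⟩, by
              push_cast at e2; exact ⟨by simp [e1], by simp [e2], by simp [e1, e2]⟩⟩
        · obtain ⟨m, rfl⟩ := Nat.exists_eq_succ_of_ne_zero hm0.ne'
          exact ⟨Sum.inl ⟨(m, n), by simp only; omega⟩, by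
              push_cast at e1; exact ⟨by simp [e1], by simp [e2], by simp [e1, e2]; linarith⟩⟩
    · have hmn : (m + n + 1 : ℝ) < N := by linarith
      have hmn : m + n + 1 < N := by exact_mod_cast hmn
      exact ⟨Sum.inr ⟨(m, n), hmn⟩, hz⟩
  affine := by
    rintro (⟨⟨m, n⟩, h⟩ | ⟨⟨m, n⟩, h⟩) z hz w hw
    · rw [plExtension_of_mem_upCell hz, plExtension_of_mem_upCell hw]
      simp only [upMap, Complex.real_smul, Sum.elim_inl]
      push_cast
      ring
    · rw [plExtension_of_mem_downCell hz, plExtension_of_mem_downCell hw]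
      simp only [downMap, Complex.real_smul, Sum.elim_inr]
      push_cast
      ring
  det_pos := by
    rintro (⟨⟨m, n⟩, h⟩ | ⟨⟨m, n⟩, h⟩)
    · exact hH.up m n
    · have := hH.down m n
      simp only [cross, Complex.sub_re, Complex.sub_im, Sum.elim_inr] at this ⊢
      linarith
  map_zero := by
    have := plExtension_natCast (H := H) 0 0
    rw [hH.map_zero] at this
    simpa [Prod.mk_zero_zero] using this
  re_pos := by
    rintro (⟨⟨m, n⟩, h⟩ | ⟨⟨m, n⟩, h⟩) z hz hz0
    · exact pos_plExtension_of_mem_upCell Complex.reLm hz hz0 hH.map_zero (hH.re_pos m n)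
        (hH.re_pos _ _ (by simp)) (hH.re_pos _ _ (by simp))
    · exact pos_plExtension_of_mem_downCell Complex.reLm hz
        (hH.re_pos _ _ (by simp)) (hH.re_pos _ _ (by simp)) (hH.re_pos _ _ (by simp))
  row_pos := by
    rintro (⟨⟨m, n⟩, h⟩ | ⟨⟨m, n⟩, h⟩) z hz hz0
    · refine pos_plExtension_of_mem_upCell (crossLeft _) hz hz0 hH.map_zero (fun h0 => ?_) ?_ ?_
      all_goals
        simp only [crossLeft, LinearMap.coe_mk, AddHom.coe_mk, Sum.elim_inl,
          sub_sub_sub_cancel_right,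
          cross_sub_right, cross_self]
      · rcases h0 with h0 | h0
        · have a1 := hH.cross_pos m n m (n + 1) (by have := Nat.pos_of_ne_zero h0; nlinarith)
          have a2 := hH.cross_nonneg (m + 1) n m n (by nlinarith)
          rw [cross_comm] at a2
          linarith
        · have a1 := hH.cross_nonneg m n m (n + 1) (by nlinarith)
          have a2 := hH.cross_pos (m + 1) n m n (by have := Nat.pos_of_ne_zero h0; nlinarith)
          rw [cross_comm] at a2
          linarith
      · have a1 := hH.cross_pos (m + 1) n m (n + 1) (by nlinarith)
        linarith
      · have a1 := hH.cross_pos (m + 1) n m (n + 1) (by nlinarith)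
        rw [cross_comm] at a1
        linarith
    · refine pos_plExtension_of_mem_downCell (crossLeft _) hz ?_ ?_ ?_
      all_goals
        simp only [crossLeft, LinearMap.coe_mk, AddHom.coe_mk, Sum.elim_inr,
          sub_sub_sub_cancel_left,
          cross_sub_right, cross_self]
      · have a1 := hH.cross_pos (m + 1) (n + 1) m (n + 1) (by nlinarith)
        have a2 := hH.cross_nonneg (m + 1) n (m + 1) (n + 1) (by nlinarith)
        rw [cross_comm] at a2
        linarith
      · have a1 := hH.cross_pos (m + 1) n m (n + 1) (by nlinarith)
        rw [cross_comm] at a1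
        linarith
      · have a1 := hH.cross_pos (m + 1) n m (n + 1) (by nlinarith)
        linarith
  left := by
    intro s hs z h1 h2
    have key : ∀ k, 0 ≤ cross (H k 0) (plExtension H z) := fun k =>
      cross_plExtension_nonneg (fun m n => hH.cross_nonneg _ _ _ _ (by simp)) h1 h2
    have hfl := Nat.floor_le hs
    have hfl' := (Nat.lt_floor_add_one s).le
    rw [plExtension_eq_of_mem_upCell (m := ⌊s⌋₊) (n := 0) ⟨hfl, by simp, by simpa using hfl'⟩]
    simp only [cross_add_left, cross_smul_left, Nat.cast_zero, sub_zero, zero_mul, add_zero]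
    exact add_nonneg (mul_nonneg (by linarith) (key _)) (mul_nonneg (by linarith) (key _))
  right := by
    intro s hs z h1 h2
    have key : ∀ k, 0 ≤ cross (plExtension H z) (H 0 k) := fun k => by
      have := cross_plExtension_nonneg (w := (-1 : ℝ) • H 0 k) (H := H) (fun m n => by
        have := hH.cross_nonneg m n 0 k (by simp)
        rw [cross_comm] at this
        rw [cross_smul_left]
        linarith) h1 h2
      rw [cross_smul_left, cross_comm] at this
      linarith
    have hfl := Nat.floor_le hs
    have hfl' := (Nat.lt_floor_add_one s).le
    rw [plExtension_eq_of_mem_upCell (z := (0, s)) (m := 0) (n := ⌊s⌋₊)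
      ⟨by simp, hfl, by simpa using hfl'⟩]
    simp only [cross_add_right, cross_smul_right, Nat.cast_zero, sub_zero, zero_mul, add_zero,
      zero_add]
    exact add_nonneg (mul_nonneg (by linarith) (key _)) (mul_nonneg (by linarith) (key _))

end PowerMap

namespace PowerMap
open Filter Topology

/-! ### Singular values and distortion of an affine map -/

lemma abs_cross_le (a b : ℂ) : |cross a b| ≤ ‖a‖ * ‖b‖ := by
  rw [cross_eq_norm_mul_sin, abs_mul, abs_of_nonneg (by positivity : 0 ≤ ‖a‖ * ‖b‖)]
  exact mul_le_of_le_one_right (by positivity) (Real.abs_sin_le_one _)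

/-- Cramer's rule. -/
lemma eq_smul_add_smul {e₁ e₂ : ℂ} (h : cross e₁ e₂ ≠ 0) (z : ℂ) :
    z = (cross z e₂ / cross e₁ e₂) • e₁ + (cross e₁ z / cross e₁ e₂) • e₂ := by
  have key : (cross e₁ e₂ : ℝ) • z = cross z e₂ • e₁ + cross e₁ z • e₂ := by
    apply Complex.ext <;> simp only [cross, Complex.add_re, Complex.add_im, Complex.smul_re,
      Complex.smul_im, smul_eq_mul] <;> ring
  rw [div_eq_inv_mul, div_eq_inv_mul, mul_smul, mul_smul, ← smul_add, ← key, inv_smul_smul₀ h]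

/-- The vector is an eigenvector of `L* L` for the eigenvalue `σₙ ^ 2`. -/
lemma exists_norm_eq_singularValue_mul (L : ℂ →ₗ[ℝ] ℂ) {n : ℕ} (hn : n < 2) :
    ∃ x : ℂ, x ≠ 0 ∧ ‖L x‖ = L.singularValues n * ‖x‖ := by
  have := L.hasEigenvalue_adjoint_comp_self_sq_singularValues
    (n := n) (by rwa [Complex.finrank_real_complex])
  obtain ⟨x, hx⟩ := this.exists_hasEigenvector
  refine ⟨x, hx.2, ?_⟩
  have h1 := hx.apply_eq_smul
  have h2 : ‖L x‖ ^ 2 = (L.singularValues n * ‖x‖) ^ 2 := by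
    rw [← real_inner_self_eq_norm_sq, ← LinearMap.adjoint_inner_left, ← LinearMap.comp_apply, h1,
      real_inner_smul_left, real_inner_self_eq_norm_sq, RCLike.ofReal_real_eq_id, id, mul_pow]
  exact (sq_eq_sq₀ (norm_nonneg _) (mul_nonneg (L.singularValues_nonneg n) (norm_nonneg _))).1 h2

/-- The distortion of an affine map is controlled by the shape of the image of one triangle. -/
lemma distortion_le {A : ℂ →ᵃ[ℝ] ℂ} {e₁ e₂ : ℂ} {K : ℝ} (he : 0 < cross e₁ e₂)
    (hdet : 0 < cross (A.linear e₁) (A.linear e₂))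
    (hK : ‖A.linear e₁‖ ^ 2 + ‖A.linear e₂‖ ^ 2 ≤ K * cross (A.linear e₁) (A.linear e₂)) :
    distortion A ≤ ENNReal.ofReal (K * ((‖e₁‖ + ‖e₂‖) ^ 2 / cross e₁ e₂)) := by
  set L := A.linear
  set D := cross (L e₁) (L e₂)
  set δ := cross e₁ e₂
  set M := √(‖L e₁‖ ^ 2 + ‖L e₂‖ ^ 2)
  set κ := (‖e₁‖ + ‖e₂‖) / δ
  have he1 : 0 < ‖e₁‖ := norm_pos_iff.2 (by rintro rfl; simp [δ, cross] at he)
  have hL1 : 0 < ‖L e₁‖ := norm_pos_iff.2 fun h => by simp [D, cross, h] at hdet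
  have hM : 0 < M := Real.sqrt_pos.2 (by positivity)
  have hκ : 0 < κ := by positivity
  have hM2 : M ^ 2 = ‖L e₁‖ ^ 2 + ‖L e₂‖ ^ 2 := Real.sq_sqrt (by positivity)
  have hM1 : ‖L e₁‖ ≤ M := Real.le_sqrt_of_sq_le (by linarith [sq_nonneg ‖L e₂‖])
  have hM2' : ‖L e₂‖ ≤ M := Real.le_sqrt_of_sq_le (by linarith [sq_nonneg ‖L e₁‖])
  have hexp : ∀ z, L z = (cross z e₂ / δ) • L e₁ + (cross e₁ z / δ) • L e₂ := by
    intro z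
    conv_lhs => rw [eq_smul_add_smul he.ne' z]
    rw [map_add, map_smul, map_smul]
  have hup : ∀ z, ‖L z‖ ≤ κ * M * ‖z‖ := by
    intro z
    rw [hexp z]
    refine (norm_add_le _ _).trans ?_
    rw [norm_smul, norm_smul, Real.norm_eq_abs, Real.norm_eq_abs, abs_div, abs_div, abs_of_pos he]
    have h1 : |cross z e₂| / δ * ‖L e₁‖ ≤ ‖z‖ * ‖e₂‖ / δ * M := by
      gcongr; exact abs_cross_le _ _
    have h2 : |cross e₁ z| / δ * ‖L e₂‖ ≤ ‖e₁‖ * ‖z‖ / δ * M := by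
      gcongr; exact abs_cross_le _ _
    calc _ ≤ ‖z‖ * ‖e₂‖ / δ * M + ‖e₁‖ * ‖z‖ / δ * M := add_le_add h1 h2
      _ = κ * M * ‖z‖ := by simp only [κ]; ring
  have hlow : ∀ z, z ≠ 0 → D / (δ * (κ * M)) * ‖z‖ ≤ ‖L z‖ := by
    intro z hz
    have hz' : 0 < ‖z‖ := norm_pos_iff.2 hz
    -- `z` and `i z` span a square of area `‖z‖ ^ 2`, and `L` multiplies areas by `D / δ`. Together
    -- with the upper bound for `‖L (i z)‖` this bounds `‖L z‖` from below.
    have e : cross (L z) (L (Complex.I * z)) = D / δ * ‖z‖ ^ 2 := by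
      rw [hexp z, hexp (Complex.I * z)]
      simp only [cross_add_left, cross_add_right, cross_smul_left, cross_smul_right, cross_self]
      rw [cross_comm (L e₂) (L e₁), ← Complex.normSq_eq_norm_sq, Complex.normSq_apply]
      have : (cross z e₂ * cross e₁ (Complex.I * z) - cross e₁ z * cross (Complex.I * z) e₂) =
          δ * (z.re * z.re + z.im * z.im) := by
        simp only [cross, δ, Complex.mul_re, Complex.mul_im, Complex.I_re, Complex.I_im]
        ring
      field_simp
      linear_combination D * this
    have h1 := (le_abs_self _).trans (abs_cross_le (L z) (L (Complex.I * z)))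
    rw [e] at h1
    have h2 := hup (Complex.I * z)
    rw [norm_mul, Complex.norm_I, one_mul] at h2
    have h3 := h1.trans (mul_le_mul_of_nonneg_left h2 (norm_nonneg (L z)))
    rw [div_mul_eq_mul_div, div_le_iff₀ (by positivity)]
    have h4 : D / δ * ‖z‖ ≤ ‖L z‖ * (κ * M) := by
      refine le_of_mul_le_mul_right ?_ hz'
      calc _ = D / δ * ‖z‖ ^ 2 := by ring
        _ ≤ _ := h3
        _ = _ := by ring
    calc D * ‖z‖ = δ * (D / δ * ‖z‖) := by field_simp
      _ ≤ δ * (‖L z‖ * (κ * M)) := by gcongr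
      _ = _ := by ring
  obtain ⟨x, hx, hx'⟩ := exists_norm_eq_singularValue_mul L (n := 0) (by norm_num)
  obtain ⟨y, hy, hy'⟩ := exists_norm_eq_singularValue_mul L (n := 1) (by norm_num)
  have hσ0 : L.singularValues 0 ≤ κ * M := by
    have := hup x
    rw [hx'] at this
    exact le_of_mul_le_mul_right this (norm_pos_iff.2 hx)
  have hσ1 : D / (δ * (κ * M)) ≤ L.singularValues 1 := by
    have := hlow y hy
    rw [hy'] at this
    exact le_of_mul_le_mul_right this (norm_pos_iff.2 hy)
  have hpos : 0 < D / (δ * (κ * M)) := by positivity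
  have hσ1' : 0 < L.singularValues 1 := hpos.trans_le hσ1
  rw [distortion, if_neg hσ1'.ne']
  apply ENNReal.ofReal_le_ofReal
  calc L.singularValues 0 / L.singularValues 1 ≤ κ * M / (D / (δ * (κ * M))) := by
        gcongr
    _ = κ ^ 2 * δ * M ^ 2 / D := by field_simp
    _ ≤ κ ^ 2 * δ * (K * D) / D := by rw [hM2]; gcongr
    _ = K * ((‖e₁‖ + ‖e₂‖) ^ 2 / δ) := by simp only [κ]; field_simp

/-! ### The faces of the subdivision as grid triangles -/

lemma Triangle.mem_region_iff (t : Triangle) (z : ℂ) :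
    z ∈ t.region ↔ ∃ a b c : ℝ, 0 ≤ a ∧ 0 ≤ b ∧ 0 ≤ c ∧ a + b + c = 1 ∧
      z = a • t 0 + b • t 1 + c • t 2 := by
  constructor
  · intro hz
    have : t.region ⊆ {z | ∃ a b c : ℝ, 0 ≤ a ∧ 0 ≤ b ∧ 0 ≤ c ∧ a + b + c = 1 ∧
        z = a • t 0 + b • t 1 + c • t 2} := by
      apply convexHull_min
      · rintro _ ⟨i, rfl⟩
        fin_cases i
        · exact ⟨1, 0, 0, by simp⟩
        · exact ⟨0, 1, 0, by simp⟩
        · exact ⟨0, 0, 1, by simp⟩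
      · rintro _ ⟨a, b, c, ha, hb, hc, hs, rfl⟩ _
          ⟨a', b', c', ha', hb', hc', hs', rfl⟩ p q hp hq hpq
        refine ⟨p * a + q * a', p * b + q * b', p * c + q * c', by positivity, by positivity,
          by positivity, ?_, by module⟩
        linear_combination p * hs + q * hs' + hpq
    exact this hz
  · rintro ⟨a, b, c, ha, hb, hc, hs, rfl⟩
    have hm : ∀ i, t i ∈ t.region := fun i => subset_convexHull ℝ _ ⟨i, rfl⟩
    have := (convex_convexHull ℝ (Set.range t)).sum_mem (t := Finset.univ) (w := ![a, b, c])
      (z := t) (fun i _ => by fin_cases i <;> simpa) (by simp [Fin.sum_univ_three, hs])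
      (fun i _ => hm i)
    simpa [Fin.sum_univ_three, region] using this

/-- A point with a barycentric coordinate at least `1/2` lies in the corner triangle at that vertex;
otherwise it lies in the middle one. -/
lemma Triangle.region_subset_split (t : Triangle) : t.region ⊆ ⋃ s ∈ t.split, s.region := by
  intro z hz
  obtain ⟨a, b, c, ha, hb, hc, hs, rfl⟩ := (t.mem_region_iff z).1 hz
  simp only [split, Set.mem_insert_iff, Set.mem_singleton_iff, Set.iUnion_iUnion_eq_or_left,
    Set.iUnion_iUnion_eq_left, Set.mem_union, mem_region_iff]
  have e : ∀ x y : ℂ, midpoint ℝ x y = (2⁻¹ : ℝ) • x + (2⁻¹ : ℝ) • y := by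
    intro x y; rw [midpoint_eq_smul_add]; simp
  by_cases h0 : 1 ≤ 2 * a
  · left
    refine ⟨2 * a - 1, 2 * b, 2 * c, by linarith, by linarith, by linarith, by linarith, ?_⟩
    simp only [Matrix.cons_val_zero, Matrix.cons_val_one, Matrix.cons_val, e]
    have : b = 1 - a - c := by linarith
    subst this
    module
  by_cases h1 : 1 ≤ 2 * b
  · right; left
    refine ⟨2 * a, 2 * b - 1, 2 * c, by linarith, by linarith, by linarith, by linarith, ?_⟩
    simp only [Matrix.cons_val_zero, Matrix.cons_val_one, Matrix.cons_val, e]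
    have : b = 1 - a - c := by linarith
    subst this
    module
  by_cases h2 : 1 ≤ 2 * c
  · right; right; left
    refine ⟨2 * a, 2 * b, 2 * c - 1, by linarith, by linarith, by linarith, by linarith, ?_⟩
    simp only [Matrix.cons_val_zero, Matrix.cons_val_one, Matrix.cons_val, e]
    have : b = 1 - a - c := by linarith
    subst this
    module
  · right; right; right
    refine ⟨1 - 2 * c, 1 - 2 * a, 1 - 2 * b, by linarith, by linarith, by linarith, by linarith, ?_⟩
    simp only [Matrix.cons_val_zero, Matrix.cons_val_one, Matrix.cons_val, e]
    have : b = 1 - a - c := by linarith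
    subst this
    module

lemma region_subset_iUnion_subdivision (T : Triangle) (q : ℕ) :
    T.region ⊆ ⋃ t ∈ subdivision T q, t.region := by
  induction q with
  | zero => simp [subdivision]
  | succ q ih =>
    intro z hz
    obtain ⟨t, ht, hzt⟩ := Set.mem_iUnion₂.1 (ih hz)
    obtain ⟨s, hs, hzs⟩ := Set.mem_iUnion₂.1 (t.region_subset_split hzt)
    exact Set.mem_iUnion₂.2 ⟨s, Set.mem_iUnion₂.2 ⟨t, ht, hs⟩, hzs⟩

/-- The points of the lattice spanned by `2⁻ᵠ e₁` and `2⁻ᵠ e₂`. -/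
noncomputable def gridPoint (e₁ e₂ : ℂ) (q m n : ℕ) : ℂ :=
  ((m : ℝ) / 2 ^ q) • e₁ + ((n : ℝ) / 2 ^ q) • e₂

lemma gridPoint_swap (e₁ e₂ : ℂ) (q m n : ℕ) :
    gridPoint e₁ e₂ q m n = gridPoint e₂ e₁ q n m := add_comm _ _

lemma gridPoint_succ (e₁ e₂ : ℂ) (q m n : ℕ) :
    gridPoint e₁ e₂ q m n = gridPoint e₁ e₂ (q + 1) (2 * m) (2 * n) := by
  simp only [gridPoint]
  push_cast
  rw [pow_succ', mul_div_mul_left _ _ two_ne_zero, mul_div_mul_left _ _ two_ne_zero]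

lemma midpoint_gridPoint (e₁ e₂ : ℂ) (q m n m' n' : ℕ) :
    midpoint ℝ (gridPoint e₁ e₂ q m n) (gridPoint e₁ e₂ q m' n') =
      gridPoint e₁ e₂ (q + 1) (m + m') (n + n') := by
  rw [midpoint_eq_smul_add]
  simp only [gridPoint, pow_succ]
  push_cast
  simp only [invOf_eq_inv]
  match_scalars <;> field_simp

/-- The ordered triangles that arise from `![a, b, c]` by rotation. -/
def IsRotation (t : Triangle) (a b c : ℂ) : Prop :=
  t = ![a, b, c] ∨ t = ![b, c, a] ∨ t = ![c, a, b]

lemma IsRotation.range_eq {t : Triangle} {a b c : ℂ} (h : IsRotation t a b c) :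
    Set.range t = {a, b, c} := by
  rcases h with rfl | rfl | rfl <;>
  · ext x
    simp only [Set.mem_range, Fin.exists_fin_succ, Matrix.cons_val_zero, Matrix.cons_val_succ,
      Set.mem_insert_iff, Set.mem_singleton_iff, eq_comm (a := x)]
    simp
    try tauto

lemma IsRotation.rotate {t : Triangle} {a b c : ℂ} (h : IsRotation t a b c) :
    IsRotation t b c a := by
  rcases h with h | h | h
  · exact Or.inr (Or.inr h)
  · exact Or.inl h
  · exact Or.inr (Or.inl h)

/-- The rotations of the faces of the `q`-th level of subdivision of the triangle with vertices
`e₁`, `0`, `e₂`. -/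
def IsOrderedGridFace (e₁ e₂ : ℂ) (q : ℕ) (t : Triangle) : Prop := ∃ m n : ℕ,
  (m + n + 1 ≤ 2 ^ q ∧ IsRotation t (gridPoint e₁ e₂ q (m + 1) n) (gridPoint e₁ e₂ q m n)
    (gridPoint e₁ e₂ q m (n + 1))) ∨
  (m + n + 2 ≤ 2 ^ q ∧ IsRotation t (gridPoint e₁ e₂ q m (n + 1))
    (gridPoint e₁ e₂ q (m + 1) (n + 1)) (gridPoint e₁ e₂ q (m + 1) n))

/-- Splitting respects the cyclic order of the vertices but not the starting vertex: the middle face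
begins elsewhere in the grid labelling. Tracking faces up to rotation makes the induction over the
levels close. -/
lemma IsRotation.split {t s : Triangle} {a b c : ℂ} (h : IsRotation t a b c) (hs : s ∈ t.split) :
    IsRotation s a (midpoint ℝ a b) (midpoint ℝ c a) ∨
    IsRotation s (midpoint ℝ a b) b (midpoint ℝ b c) ∨
    IsRotation s (midpoint ℝ c a) (midpoint ℝ b c) c ∨
    IsRotation s (midpoint ℝ a b) (midpoint ℝ b c) (midpoint ℝ c a) := by
  simp only [Triangle.split, Set.mem_insert_iff, Set.mem_singleton_iff] at hs
  rcases h with rfl | rfl | rfl <;> rcases hs with rfl | rfl | rfl | rfl <;>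
    simp only [IsRotation, Matrix.cons_val_zero, Matrix.cons_val_one, Matrix.cons_val,
      midpoint_comm (R := ℝ) a c, midpoint_comm (R := ℝ) c b, midpoint_comm (R := ℝ) b a,
      true_or, or_true]

lemma isOrderedGridFace_of_mem_subdivision (e₁ e₂ : ℂ) (q : ℕ) {t : Triangle}
    (ht : t ∈ subdivision ![e₁, 0, e₂] q) : IsOrderedGridFace e₁ e₂ q t := by
  induction q generalizing t with
  | zero =>
    refine ⟨0, 0, Or.inl ⟨by simp, Or.inl ?_⟩⟩
    rw [subdivision, Set.mem_singleton_iff] at ht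
    simp [ht, gridPoint]
  | succ q ih =>
    obtain ⟨s, hs, hts⟩ := Set.mem_iUnion₂.1 ht
    obtain ⟨m, n, ⟨hmn, hrot⟩ | ⟨hmn, hrot⟩⟩ := ih hs
    · rcases hrot.split hts with h | h | h | h
      · refine ⟨2 * m + 1, 2 * n, Or.inl ⟨by rw [pow_succ]; omega, ?_⟩⟩
        rw [midpoint_gridPoint, midpoint_gridPoint, gridPoint_succ _ _ q] at h
        convert! h using 2 <;> ring
      · refine ⟨2 * m, 2 * n, Or.inl ⟨by rw [pow_succ]; omega, ?_⟩⟩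
        rw [midpoint_gridPoint, midpoint_gridPoint, gridPoint_succ _ _ q] at h
        convert! h using 2 <;> ring
      · refine ⟨2 * m, 2 * n + 1, Or.inl ⟨by rw [pow_succ]; omega, ?_⟩⟩
        rw [midpoint_gridPoint, midpoint_gridPoint, gridPoint_succ _ _ q] at h
        convert! h using 2 <;> ring
      · refine ⟨2 * m, 2 * n, Or.inr ⟨by rw [pow_succ]; omega, ?_⟩⟩
        rw [midpoint_gridPoint, midpoint_gridPoint, midpoint_gridPoint] at h
        convert! h.rotate using 2 <;> ring
    · rcases hrot.split hts with h | h | h | h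
      · refine ⟨2 * m, 2 * n + 1, Or.inr ⟨by rw [pow_succ]; omega, ?_⟩⟩
        rw [midpoint_gridPoint, midpoint_gridPoint, gridPoint_succ _ _ q] at h
        convert! h using 2 <;> ring
      · refine ⟨2 * m + 1, 2 * n + 1, Or.inr ⟨by rw [pow_succ]; omega, ?_⟩⟩
        rw [midpoint_gridPoint, midpoint_gridPoint, gridPoint_succ _ _ q] at h
        convert! h using 2 <;> ring
      · refine ⟨2 * m + 1, 2 * n, Or.inr ⟨by rw [pow_succ]; omega, ?_⟩⟩
        rw [midpoint_gridPoint, midpoint_gridPoint, gridPoint_succ _ _ q] at h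
        convert! h using 2 <;> ring
      · refine ⟨2 * m + 1, 2 * n + 1, Or.inl ⟨by rw [pow_succ]; omega, ?_⟩⟩
        rw [midpoint_gridPoint, midpoint_gridPoint, midpoint_gridPoint] at h
        convert! h.rotate using 2 <;> ring

/-- The triangles whose vertices are those of a face of the `q`-th level of subdivision of the
triangle with vertices `e₁`, `0`, `e₂`. -/
def IsGridFace (e₁ e₂ : ℂ) (q : ℕ) (t : Triangle) : Prop := ∃ m n : ℕ,
  (m + n + 1 ≤ 2 ^ q ∧ Set.range t = {gridPoint e₁ e₂ q (m + 1) n, gridPoint e₁ e₂ q m n,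
    gridPoint e₁ e₂ q m (n + 1)}) ∨
  (m + n + 2 ≤ 2 ^ q ∧ Set.range t = {gridPoint e₁ e₂ q m (n + 1),
    gridPoint e₁ e₂ q (m + 1) (n + 1), gridPoint e₁ e₂ q (m + 1) n})

lemma IsOrderedGridFace.isGridFace {e₁ e₂ : ℂ} {q : ℕ} {t : Triangle}
    (h : IsOrderedGridFace e₁ e₂ q t) : IsGridFace e₁ e₂ q t := by
  obtain ⟨m, n, ⟨hmn, hrot⟩ | ⟨hmn, hrot⟩⟩ := h
  · exact ⟨m, n, Or.inl ⟨hmn, hrot.range_eq⟩⟩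
  · exact ⟨m, n, Or.inr ⟨hmn, hrot.range_eq⟩⟩

/-- Forgetting the order of the vertices makes the description symmetric in `e₁` and `e₂`, so a
negatively oriented triangle can be treated with the two sides exchanged. -/
lemma IsGridFace.swap {e₁ e₂ : ℂ} {q : ℕ} {t : Triangle} (h : IsGridFace e₁ e₂ q t) :
    IsGridFace e₂ e₁ q t := by
  obtain ⟨m, n, ⟨hmn, hr⟩ | ⟨hmn, hr⟩⟩ := h
  · refine ⟨n, m, Or.inl ⟨by omega, ?_⟩⟩
    simp only [hr, gridPoint_swap e₁ e₂]
    ext x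
    simp only [Set.mem_insert_iff, Set.mem_singleton_iff]
    tauto
  · refine ⟨n, m, Or.inr ⟨by omega, ?_⟩⟩
    simp only [hr, gridPoint_swap e₁ e₂]
    ext x
    simp only [Set.mem_insert_iff, Set.mem_singleton_iff]
    tauto

end PowerMap

namespace PowerMap
open Filter Topology

/-! ### The simplicial interpolant in grid coordinates -/

/-- The coordinates with respect to the basis `2⁻ᵠ e₁`, `2⁻ᵠ e₂`. -/
noncomputable def gridCoord (e₁ e₂ : ℂ) (q : ℕ) : ℂ →ₗ[ℝ] ℝ × ℝ where
  toFun z := (2 ^ q * (cross z e₂ / cross e₁ e₂), 2 ^ q * (cross e₁ z / cross e₁ e₂))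
  map_add' z w := by
    ext <;> simp only [cross_add_left, cross_add_right, Prod.fst_add, Prod.snd_add] <;> ring
  map_smul' r z := by
    ext <;> simp only [cross_smul_left, cross_smul_right, Prod.smul_fst, Prod.smul_snd,
      smul_eq_mul, RingHom.id_apply] <;> ring

lemma convex_upCell (m n : ℕ) : Convex ℝ (upCell m n) := by
  rintro x ⟨h1, h2, h3⟩ y ⟨k1, k2, k3⟩ a b ha hb hab
  have hb' : b = 1 - a := by linarith
  subst hb'
  refine ⟨?_, ?_, ?_⟩ <;>
  · simp only [Prod.fst_add, Prod.snd_add, Prod.smul_fst, Prod.smul_snd, smul_eq_mul]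
    nlinarith

lemma convex_downCell (m n : ℕ) : Convex ℝ (downCell m n) := by
  rintro x ⟨h1, h2, h3⟩ y ⟨k1, k2, k3⟩ a b ha hb hab
  have hb' : b = 1 - a := by linarith
  subst hb'
  refine ⟨?_, ?_, ?_⟩ <;>
  · simp only [Prod.fst_add, Prod.snd_add, Prod.smul_fst, Prod.smul_snd, smul_eq_mul]
    nlinarith

lemma eqOn_region {t : Triangle} {A B : ℂ →ᵃ[ℝ] ℂ} (h : ∀ i, A (t i) = B (t i)) :
    Set.EqOn A B t.region := by
  refine convexHull_min (t := {z | A z = B z}) ?_ ?_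
  · rintro _ ⟨i, rfl⟩
    exact h i
  · intro x hx y hy a b _ _ hab
    have hx : A x = B x := hx
    have hy : A y = B y := hy
    change A _ = B _
    rw [Convex.combo_affine_apply hab, Convex.combo_affine_apply hab, hx, hy]

lemma exists_affineMap (f : ℂ →ₗ[ℝ] ℝ × ℝ) (c k a b : ℂ) :
    ∃ A : ℂ →ᵃ[ℝ] ℂ, ∀ z, A z = c * (k + (f z).1 • a + (f z).2 • b) := by
  refine ⟨((LinearMap.mulLeft ℝ c ∘ₗ ((LinearMap.fst ℝ ℝ ℝ).smulRight a +
    (LinearMap.snd ℝ ℝ ℝ).smulRight b)) ∘ₗ f).toAffineMap + AffineMap.const ℝ ℂ (c * k),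
    fun z => ?_⟩
  simp
  ring

variable {e₁ e₂ : ℂ} {q : ℕ} {t : Triangle} {H : ℕ → ℕ → ℂ}

lemma gridCoord_smul_add_smul (he : cross e₁ e₂ ≠ 0) (x y : ℝ) :
    gridCoord e₁ e₂ q (x • e₁ + y • e₂) = (2 ^ q * x, 2 ^ q * y) := by
  simp only [gridCoord, LinearMap.coe_mk, AddHom.coe_mk, cross_add_left, cross_add_right,
    cross_smul_left, cross_smul_right, cross_self, mul_zero, zero_add, add_zero,
    mul_div_cancel_right₀ _ he]

lemma gridCoord_gridPoint (he : cross e₁ e₂ ≠ 0) (m n : ℕ) :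
    gridCoord e₁ e₂ q (gridPoint e₁ e₂ q m n) = ((m : ℝ), (n : ℝ)) := by
  rw [gridPoint, gridCoord_smul_add_smul he]
  ext <;> simp only <;> field_simp

lemma gridCoord_injective (he : cross e₁ e₂ ≠ 0) : Function.Injective (gridCoord e₁ e₂ q) := by
  intro z w h
  simp only [gridCoord, LinearMap.coe_mk, AddHom.coe_mk, Prod.mk.injEq,
    mul_right_inj' (pow_ne_zero q (two_ne_zero : (2 : ℝ) ≠ 0))] at h
  rw [eq_smul_add_smul he z, eq_smul_add_smul he w, h.1, h.2]

lemma gridCoord_mem_upCell (he : cross e₁ e₂ ≠ 0) {m n : ℕ}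
    (ht : Set.range t = {gridPoint e₁ e₂ q (m + 1) n, gridPoint e₁ e₂ q m n,
      gridPoint e₁ e₂ q m (n + 1)}) {z : ℂ} (hz : z ∈ t.region) :
    gridCoord e₁ e₂ q z ∈ upCell m n := by
  rw [Triangle.region, ht] at hz
  refine convexHull_min ?_ ((convex_upCell m n).linear_preimage (gridCoord e₁ e₂ q)) hz
  rintro _ (rfl | rfl | rfl) <;>
  · rw [Set.mem_preimage, gridCoord_gridPoint he]
    refine ⟨?_, ?_, ?_⟩ <;> simp only <;> push_cast <;> linarith

lemma gridCoord_mem_downCell (he : cross e₁ e₂ ≠ 0) {m n : ℕ}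
    (ht : Set.range t = {gridPoint e₁ e₂ q m (n + 1), gridPoint e₁ e₂ q (m + 1) (n + 1),
      gridPoint e₁ e₂ q (m + 1) n}) {z : ℂ} (hz : z ∈ t.region) :
    gridCoord e₁ e₂ q z ∈ downCell m n := by
  rw [Triangle.region, ht] at hz
  refine convexHull_min ?_ ((convex_downCell m n).linear_preimage (gridCoord e₁ e₂ q)) hz
  rintro _ (rfl | rfl | rfl) <;>
  · rw [Set.mem_preimage, gridCoord_gridPoint he]
    refine ⟨?_, ?_, ?_⟩ <;> simp only <;> push_cast <;> linarith

namespace IsGridFace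

lemma exists_vertex (h : IsGridFace e₁ e₂ q t) (i : Fin 3) :
    ∃ m n : ℕ, m + n ≤ 2 ^ q ∧ t i = gridPoint e₁ e₂ q m n := by
  obtain ⟨m, n, ⟨hmn, hr⟩ | ⟨hmn, hr⟩⟩ := h
  · have : t i ∈ Set.range t := ⟨i, rfl⟩
    rw [hr] at this
    rcases this with h | h | h
    · exact ⟨_, _, by omega, h⟩
    · exact ⟨_, _, by omega, h⟩
    · exact ⟨_, _, by omega, h⟩
  · have : t i ∈ Set.range t := ⟨i, rfl⟩
    rw [hr] at this
    rcases this with h | h | h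
    · exact ⟨_, _, by omega, h⟩
    · exact ⟨_, _, by omega, h⟩
    · exact ⟨_, _, by omega, h⟩

lemma exists_affineMap_eq (he : cross e₁ e₂ ≠ 0) (h : IsGridFace e₁ e₂ q t) (c : ℂ) :
    ∃ A : ℂ →ᵃ[ℝ] ℂ, ∀ z ∈ t.region, A z = c * plExtension H (gridCoord e₁ e₂ q z) := by
  obtain ⟨m, n, ⟨hmn, hr⟩ | ⟨hmn, hr⟩⟩ := h
  · obtain ⟨A, hA⟩ := exists_affineMap (gridCoord e₁ e₂ q) c
      (H m n - (m : ℝ) • (H (m + 1) n - H m n) - (n : ℝ) • (H m (n + 1) - H m n))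
      (H (m + 1) n - H m n) (H m (n + 1) - H m n)
    refine ⟨A, fun z hz => ?_⟩
    rw [plExtension_of_mem_upCell (gridCoord_mem_upCell he hr hz), hA, upMap]
    congr 1
    module
  · obtain ⟨A, hA⟩ := exists_affineMap (gridCoord e₁ e₂ q) c
      (H (m + 1) (n + 1) - (m + 1 : ℝ) • (H (m + 1) (n + 1) - H m (n + 1)) -
        (n + 1 : ℝ) • (H (m + 1) (n + 1) - H (m + 1) n))
      (H (m + 1) (n + 1) - H m (n + 1)) (H (m + 1) (n + 1) - H (m + 1) n)
    refine ⟨A, fun z hz => ?_⟩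
    rw [plExtension_of_mem_downCell (gridCoord_mem_downCell he hr hz), hA, downMap]
    congr 1
    module

end IsGridFace

section Interpolant

variable {F : Set Triangle} {h g : ℂ → ℂ} {c : ℂ}

lemma isSimplicialInterpolant_plExtension (he : cross e₁ e₂ ≠ 0)
    (hF : ∀ t ∈ F, IsGridFace e₁ e₂ q t)
    (hc : ∀ m n, m + n ≤ 2 ^ q → h (gridPoint e₁ e₂ q m n) = c * H m n) :
    IsSimplicialInterpolant F h fun z => c * plExtension H (gridCoord e₁ e₂ q z) where
  vertex t ht i := by
    obtain ⟨m, n, hmn, hti⟩ := (hF t ht).exists_vertex i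
    rw [hti, hc m n hmn, gridCoord_gridPoint he, plExtension_natCast]
  affine t ht := by
    obtain ⟨A, hA⟩ := (hF t ht).exists_affineMap_eq (H := H) he c
    exact ⟨A, fun z hz => (hA z hz).symm⟩

/-- Affine maps that agree at the vertices agree on the face, so the interpolant is determined on
every face. -/
lemma IsSimplicialInterpolant.eq_plExtension (he : cross e₁ e₂ ≠ 0)
    (hF : ∀ t ∈ F, IsGridFace e₁ e₂ q t)
    (hc : ∀ m n, m + n ≤ 2 ^ q → h (gridPoint e₁ e₂ q m n) = c * H m n)
    (hg : IsSimplicialInterpolant F h g) (ht : t ∈ F) {z : ℂ} (hz : z ∈ t.region) :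
    g z = c * plExtension H (gridCoord e₁ e₂ q z) := by
  have hg' := isSimplicialInterpolant_plExtension he hF hc
  obtain ⟨A, hA⟩ := hg.affine t ht
  obtain ⟨B, hB⟩ := hg'.affine t ht
  have hm : ∀ i, t i ∈ t.region := fun i => subset_convexHull ℝ _ ⟨i, rfl⟩
  have key : Set.EqOn A B t.region := eqOn_region fun i => by
    rw [← hA (hm i), ← hB (hm i), hg.vertex t ht i]
    exact (hg'.vertex t ht i).symm
  rw [hA hz, key hz, ← hB hz]

/-- The conformal distortion of an affine map that sends the edges of a lattice triangle to
multiples of `U` and `V`. -/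
lemma distortion_le_of_apply_eq {A : ℂ →ᵃ[ℝ] ℂ} {K : ℝ} {w U V : ℂ} (he : 0 < cross e₁ e₂)
    (hw : w ≠ 0) (h1 : A.linear e₁ = w * U) (h2 : A.linear e₂ = w * V) (hUV : 0 < cross U V)
    (hK : ‖U‖ ^ 2 + ‖V‖ ^ 2 ≤ K * cross U V) :
    distortion A ≤ ENNReal.ofReal (K * ((‖e₁‖ + ‖e₂‖) ^ 2 / cross e₁ e₂)) := by
  have hw' : 0 < ‖w‖ := norm_pos_iff.2 hw
  refine distortion_le he ?_ ?_
  · rw [h1, h2, cross_mul_left_right]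
    positivity
  · rw [h1, h2, cross_mul_left_right, norm_mul, norm_mul]
    calc _ = ‖w‖ ^ 2 * (‖U‖ ^ 2 + ‖V‖ ^ 2) := by ring
      _ ≤ ‖w‖ ^ 2 * (K * cross U V) := by gcongr
      _ = _ := by ring

lemma linear_eq_of_sub_eq {A : ℂ →ᵃ[ℝ] ℂ} {x y e : ℂ} {r : ℝ} (hr : r ≠ 0) (hxy : x - y = r • e) :
    A.linear e = r⁻¹ • (A x - A y) := by
  have := A.linearMap_vsub x y
  rw [vsub_eq_sub, vsub_eq_sub, hxy, map_smul] at this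
  rw [← this, inv_smul_smul₀ hr]

lemma simplicialDistortion_le (he : 0 < cross e₁ e₂) (hH : IsLatticeSpread H) (hc0 : c ≠ 0) {K : ℝ}
    (hK1 : ∀ m n, ‖H (m + 1) n - H m n‖ ^ 2 + ‖H m (n + 1) - H m n‖ ^ 2 ≤
      K * cross (H (m + 1) n - H m n) (H m (n + 1) - H m n))
    (hK2 : ∀ m n, ‖H m (n + 1) - H (m + 1) (n + 1)‖ ^ 2 +
      ‖H (m + 1) n - H (m + 1) (n + 1)‖ ^ 2 ≤
      K * cross (H m (n + 1) - H (m + 1) (n + 1)) (H (m + 1) n - H (m + 1) (n + 1)))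
    (hF : ∀ t ∈ F, IsGridFace e₁ e₂ q t)
    (hc : ∀ m n, m + n ≤ 2 ^ q → h (gridPoint e₁ e₂ q m n) = c * H m n)
    (hg : IsSimplicialInterpolant F h g) :
    simplicialDistortion F g ≤ ENNReal.ofReal (K * ((‖e₁‖ + ‖e₂‖) ^ 2 / cross e₁ e₂)) := by
  refine iSup₂_le fun t ht => iSup₂_le fun A hA => ?_
  have hval : ∀ m n, gridPoint e₁ e₂ q m n ∈ Set.range t →
      A (gridPoint e₁ e₂ q m n) = c * H m n := by
    intro m n hmem
    have hreg : gridPoint e₁ e₂ q m n ∈ t.region := subset_convexHull ℝ _ hmem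
    rw [← hA hreg, hg.eq_plExtension he.ne' hF hc ht hreg, gridCoord_gridPoint he.ne',
      plExtension_natCast]
  have h2q : (2 : ℝ) ^ q ≠ 0 := by positivity
  obtain ⟨m, n, ⟨hmn, hr⟩ | ⟨hmn, hr⟩⟩ := hF t ht
  · have a1 := hval (m + 1) n (by simp [hr])
    have a2 := hval m n (by simp [hr])
    have a3 := hval m (n + 1) (by simp [hr])
    have s1 : gridPoint e₁ e₂ q (m + 1) n - gridPoint e₁ e₂ q m n = ((2 : ℝ) ^ q)⁻¹ • e₁ := by
      simp only [gridPoint]; push_cast; module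
    have s2 : gridPoint e₁ e₂ q m (n + 1) - gridPoint e₁ e₂ q m n = ((2 : ℝ) ^ q)⁻¹ • e₂ := by
      simp only [gridPoint]; push_cast; module
    -- The mesh size `2⁻ᵠ` and the constant `c` enter only through the similarity `w`, which does
    -- not affect distortion; so the bound is independent of `q`.
    refine distortion_le_of_apply_eq (w := (2 ^ q : ℝ) * c) he
      (mul_ne_zero (by exact_mod_cast h2q) hc0) ?_ ?_ (hH.up m n) (hK1 m n)
    · rw [linear_eq_of_sub_eq (inv_ne_zero h2q) s1, a1, a2, inv_inv, Complex.real_smul]; ring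
    · rw [linear_eq_of_sub_eq (inv_ne_zero h2q) s2, a3, a2, inv_inv, Complex.real_smul]; ring
  · have a1 := hval m (n + 1) (by simp [hr])
    have a2 := hval (m + 1) (n + 1) (by simp [hr])
    have a3 := hval (m + 1) n (by simp [hr])
    have s1 : gridPoint e₁ e₂ q m (n + 1) - gridPoint e₁ e₂ q (m + 1) (n + 1) =
        (-((2 : ℝ) ^ q)⁻¹) • e₁ := by
      simp only [gridPoint]; push_cast; module
    have s2 : gridPoint e₁ e₂ q (m + 1) n - gridPoint e₁ e₂ q (m + 1) (n + 1) =
        (-((2 : ℝ) ^ q)⁻¹) • e₂ := by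
      simp only [gridPoint]; push_cast; module
    refine distortion_le_of_apply_eq (w := (-2 ^ q : ℝ) * c) he
      (mul_ne_zero (by exact_mod_cast neg_ne_zero.2 h2q) hc0) ?_ ?_ (hH.down m n) (hK2 m n)
    · rw [linear_eq_of_sub_eq (neg_ne_zero.2 (inv_ne_zero h2q)) s1, a1, a2, inv_neg, inv_inv,
        Complex.real_smul]; ring
    · rw [linear_eq_of_sub_eq (neg_ne_zero.2 (inv_ne_zero h2q)) s2, a3, a2, inv_neg, inv_inv,
        Complex.real_smul]; ring

/-- A continuous injection of a compact space into a Hausdorff space is an embedding; injectivity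
comes from `IsSpread.injOn` with `N = 2 ^ q`. -/
lemma isEmbedding_of_isSimplicialInterpolant (he : cross e₁ e₂ ≠ 0) (hH : IsLatticeSpread H)
    (hc0 : c ≠ 0) (hF : ∀ t ∈ F, IsGridFace e₁ e₂ q t)
    (hc : ∀ m n, m + n ≤ 2 ^ q → h (gridPoint e₁ e₂ q m n) = c * H m n)
    (hg : IsSimplicialInterpolant F h g) {R : Set ℂ} (hRc : IsCompact R)
    (hR : ∀ x y : ℝ, x • e₁ + y • e₂ ∈ R ↔ 0 ≤ x ∧ 0 ≤ y ∧ x + y ≤ 1)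
    (hcov : R ⊆ ⋃ t ∈ F, t.region) : IsEmbedding (R.domRestrict g) := by
  have hs := hH.isSpread (N := 2 ^ q) Nat.one_le_two_pow
  have heq : Set.EqOn g (fun z => c * plExtension H (gridCoord e₁ e₂ q z)) R := by
    intro z hz
    obtain ⟨t, ht, hzt⟩ := Set.mem_iUnion₂.1 (hcov hz)
    exact hg.eq_plExtension he hF hc ht hzt
  have hmaps : Set.MapsTo (gridCoord e₁ e₂ q) R
      {z | 0 ≤ z.1 ∧ 0 ≤ z.2 ∧ z.1 + z.2 ≤ ((2 ^ q : ℕ) : ℝ)} := by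
    intro z hz
    rw [eq_smul_add_smul he z] at hz ⊢
    obtain ⟨h1, h2, h3⟩ := (hR _ _).1 hz
    rw [gridCoord_smul_add_smul he]
    refine ⟨by positivity, by positivity, ?_⟩
    simp only
    rw [← mul_add]
    push_cast
    exact mul_le_of_le_one_right (by positivity) h3
  have hcont : ContinuousOn g R := by
    refine ContinuousOn.congr ?_ heq
    exact (hs.continuousOn.comp
      (gridCoord e₁ e₂ q).continuous_of_finiteDimensional.continuousOn hmaps).const_mul c
  have hinj : Set.InjOn g R := by
    intro z hz w hw hzw
    rw [heq hz, heq hw] at hzw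
    exact gridCoord_injective he (hs.injOn (hmaps hz) (hmaps hw) (mul_left_cancel₀ hc0 hzw))
  have : CompactSpace R := isCompact_iff_compactSpace.1 hRc
  exact (hcont.domRestrict.isClosedEmbedding (Set.injOn_iff_injective.1 hinj)).isEmbedding

end Interpolant

/-- On a triangle that is contained in a sector, a branch of the power map is a multiple of the
principal branch. -/
lemma IsPowerBranch.exists_eq_mul_cpow {γ : ℝ} (hγ : 0 < γ) (he : 0 < cross e₁ e₂)
    (hre : 0 < (e₂ / e₁).re) {R : Set ℂ} (hRconv : Convex ℝ R)
    (hR : ∀ x y : ℝ, x • e₁ + y • e₂ ∈ R ↔ 0 ≤ x ∧ 0 ≤ y ∧ x + y ≤ 1) {h : ℂ → ℂ}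
    (hh : IsPowerBranch γ R h) :
    ∃ c ≠ 0, ∀ z ∈ R, h z = c * (z / e₁) ^ (γ : ℂ) := by
  have he1 : e₁ ≠ 0 := by rintro rfl; simp [cross] at he
  obtain ⟨ℓ, hℓc, hℓ⟩ := hh.exists_log
  have hpos : ∀ z ∈ R \ {0}, 0 < (z / e₁).re := by
    rintro z ⟨hz, hz0⟩
    have hz0 : z ≠ 0 := hz0
    have ez := eq_smul_add_smul he.ne' z
    set x := cross z e₂ / cross e₁ e₂
    set y := cross e₁ z / cross e₁ e₂
    rw [ez] at hz hz0 ⊢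
    obtain ⟨hx, hy, -⟩ := (hR _ _).1 hz
    have e : (x • e₁ + y • e₂) / e₁ = x + y * (e₂ / e₁) := by
      simp only [Complex.real_smul]; field_simp
    rw [e, Complex.add_re, Complex.ofReal_re, Complex.re_ofReal_mul]
    rcases hx.lt_or_eq with hx' | hx'
    · positivity
    rcases hy.lt_or_eq with hy' | hy'
    · positivity
    exact absurd (by simp [← hx', ← hy']) hz0
  -- Removing the vertex `0` is the same as intersecting with an open half plane, so the set stays
  -- convex.
  have hS : IsPreconnected (R \ {0}) := by
    have : R \ {0} = R ∩ (fun z : ℂ => z / e₁) ⁻¹' {w | 0 < w.re} := by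
      ext z
      constructor
      · intro hz
        exact ⟨hz.1, hpos z hz⟩
      · rintro ⟨h1, h2⟩
        exact ⟨h1, by rintro rfl; simp at h2⟩
    rw [this]
    refine (hRconv.inter ?_).isPreconnected
    have hl : (fun z : ℂ => z / e₁) = LinearMap.mulLeft ℝ e₁⁻¹ := by
      ext z; simp [div_eq_inv_mul]
    rw [hl]
    exact (convex_halfSpace_re_gt 0).linear_preimage _
  have hmem1 : e₁ ∈ R \ {0} := ⟨by simpa using (hR 1 0).2 (by simp), he1⟩
  have hlog : ContinuousOn (fun z => Complex.log (z / e₁)) (R \ {0}) := by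
    refine ContinuousOn.clog (by fun_prop) fun z hz => Or.inl (hpos z hz)
  have hexp : ∀ z ∈ R \ {0}, Complex.exp (ℓ z) = Complex.exp (ℓ e₁ + Complex.log (z / e₁)) := by
    intro z hz
    rw [Complex.exp_add, (hℓ z hz).1, (hℓ e₁ hmem1).1,
      Complex.exp_log (div_ne_zero hz.2 he1), mul_div_cancel₀ _ he1]
  have hconst : ∀ z ∈ R \ {0}, ℓ z = ℓ e₁ + Complex.log (z / e₁) := by
    -- Two branches of the logarithm differ by an integer multiple of `2πi`; `f` is that integer,
    -- continuous on a connected set and zero at `e₁`.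
    set f : ℂ → ℝ := fun z => (ℓ z - (ℓ e₁ + Complex.log (z / e₁))).im / (2 * Real.pi)
    have hf : ContinuousOn f (R \ {0}) := by
      exact (Complex.continuous_im.comp_continuousOn
        (hℓc.sub (continuousOn_const.add hlog))).div_const _
    have hfn : ∀ z ∈ R \ {0}, ∃ n : ℤ, f z = n ∧
        ℓ z = ℓ e₁ + Complex.log (z / e₁) + n * (2 * Real.pi * Complex.I) := by
      intro z hz
      obtain ⟨n, hn⟩ := Complex.exp_eq_exp_iff_exists_int.1 (hexp z hz)
      refine ⟨n, ?_, hn⟩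
      simp only [f, hn, add_sub_cancel_left]
      have : ((n : ℂ) * (2 * Real.pi * Complex.I)).im = n * (2 * Real.pi) := by simp
      rw [this]
      field_simp
    have hmaps : Set.MapsTo f (R \ {0}) (Set.range ((↑) : ℤ → ℝ)) := by
      intro z hz
      obtain ⟨n, hn, -⟩ := hfn z hz
      exact ⟨n, hn.symm⟩
    have hdisc : IsDiscrete (Set.range ((↑) : ℤ → ℝ)) :=
      ⟨Int.isClosedEmbedding_coe_real.isEmbedding.toHomeomorph.discreteTopology⟩
    intro z hz
    have h1 := hS.constant_of_mapsTo hdisc hf hmaps hz hmem1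
    have h2 : f e₁ = 0 := by simp [f, he1]
    obtain ⟨n, hn, hn'⟩ := hfn z hz
    rw [h1, h2] at hn
    have : n = 0 := by exact_mod_cast hn.symm
    rw [hn', this]
    simp
  refine ⟨Complex.exp (γ * ℓ e₁), Complex.exp_ne_zero _, fun z hz => ?_⟩
  by_cases hz0 : z = 0
  · rw [hz0, hh.map_zero]
    simp [hγ.ne']
  · have hz' : z ∈ R \ {0} := ⟨hz, hz0⟩
    rw [(hℓ z hz').2, hconst z hz', Complex.cpow_def_of_ne_zero (div_ne_zero hz0 he1),
      ← Complex.exp_add]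
    congr 1
    ring

end PowerMap

namespace PowerMap
open Filter Topology

/-! ### Self-similarity of the power map and the uniform bound -/

lemma gridPoint_div {e₁ e₂ : ℂ} (he : e₁ ≠ 0) (q m n : ℕ) :
    gridPoint e₁ e₂ q m n / e₁ = (((2 ^ q)⁻¹ : ℝ) : ℂ) * latticePoint (e₂ / e₁) (m, n) := by
  simp only [gridPoint, latticePoint, Complex.real_smul]
  push_cast
  field_simp

lemma cross_eq_norm_sq_mul_im {e₁ : ℂ} (he : e₁ ≠ 0) (e₂ : ℂ) :
    cross e₁ e₂ = ‖e₁‖ ^ 2 * (e₂ / e₁).im := by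
  have := cross_mul_left_right e₁ 1 (e₂ / e₁)
  rw [mul_one, mul_div_cancel₀ _ he] at this
  simpa [cross] using this

theorem exists_uniform_distortion_bound {e₁ e₂ : ℂ} {γ : ℝ} (hγ : 0 < γ) (he : 0 < cross e₁ e₂)
    (hv : InSector γ (e₂ / e₁)) {R : Set ℂ} (hRconv : Convex ℝ R) (hRc : IsCompact R)
    (hR : ∀ x y : ℝ, x • e₁ + y • e₂ ∈ R ↔ 0 ≤ x ∧ 0 ≤ y ∧ x + y ≤ 1) {h : ℂ → ℂ}
    (hh : IsPowerBranch γ R h) {F : ℕ → Set Triangle}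
    (hF : ∀ q, ∀ t ∈ F q, IsGridFace e₁ e₂ q t) (hcov : ∀ q, R ⊆ ⋃ t ∈ F q, t.region) :
    ∃ K : ℝ, 1 ≤ K ∧ ∀ q : ℕ, (∃ g : ℂ → ℂ, IsSimplicialInterpolant (F q) h g) ∧
      ∀ g : ℂ → ℂ, IsSimplicialInterpolant (F q) h g →
        IsEmbedding (R.domRestrict g) ∧ simplicialDistortion (F q) g ≤ ENNReal.ofReal K := by
  have he1 : e₁ ≠ 0 := by rintro rfl; simp [cross] at he
  have hvi : 0 < (e₂ / e₁).im := by
    rw [cross_eq_norm_sq_mul_im he1] at he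
    exact pos_of_mul_pos_right he (by positivity)
  have hH := isLatticeSpread_latticePower hγ hv hvi
  obtain ⟨K₁, hK₁⟩ := exists_up_bound hγ hv hvi
  obtain ⟨K₂, hK₂⟩ := exists_down_bound hγ hv hvi
  obtain ⟨c, hc0, hc⟩ := hh.exists_eq_mul_cpow hγ he hv.re_pos hRconv hR
  set K := max K₁ K₂ * ((‖e₁‖ + ‖e₂‖) ^ 2 / cross e₁ e₂)
  refine ⟨max 1 K, le_max_left _ _, fun q => ?_⟩
  have hr : (0 : ℝ) < (2 ^ q)⁻¹ := by positivity
  set r : ℂ := (((2 ^ q)⁻¹ : ℝ) : ℂ)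
  -- Homogeneity of the power: the samples at level `q` are those of the fixed lattice, multiplied
  -- by a constant that depends only on `q`.
  have hcq : ∀ m n, m + n ≤ 2 ^ q → h (gridPoint e₁ e₂ q m n) =
      c * r ^ (γ : ℂ) * latticePower γ (e₂ / e₁) (m, n) := by
    intro m n hmn
    have hmem : gridPoint e₁ e₂ q m n ∈ R := by
      rw [gridPoint, hR]
      refine ⟨by positivity, by positivity, ?_⟩
      rw [← add_div, div_le_one (by positivity)]
      exact_mod_cast hmn
    rw [hc _ hmem, gridPoint_div he1]
    by_cases hk : m ≠ 0 ∨ n ≠ 0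
    · rw [mul_cpow_of_re_pos (by rwa [Complex.ofReal_re])
        (inSector_latticePoint (k := (m, n)) hγ hv hk).re_pos,
        latticePower, mul_assoc]
    · push Not at hk
      rw [hk.1, hk.2, latticePower_zero hγ]
      simp [latticePoint, hγ.ne']
  have hcq0 : c * r ^ (γ : ℂ) ≠ 0 := mul_ne_zero hc0 (by
    have : r ≠ 0 := Complex.ofReal_ne_zero.2 hr.ne'
    simp [Complex.cpow_eq_zero_iff, this])
  refine ⟨⟨_, isSimplicialInterpolant_plExtension he.ne' (hF q) hcq⟩, fun g hg => ⟨?_, ?_⟩⟩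
  · exact isEmbedding_of_isSimplicialInterpolant he.ne' hH hcq0 (hF q) hcq hg hRc hR (hcov q)
  · refine (simplicialDistortion_le (K := max K₁ K₂) he hH hcq0 (fun m n => ?_) (fun m n => ?_)
      (hF q) hcq hg).trans (ENNReal.ofReal_le_ofReal (le_max_right _ _))
    · exact (hK₁ m n).trans (mul_le_mul_of_nonneg_right (le_max_left _ _) (hH.up m n).le)
    · exact (hK₂ m n).trans (mul_le_mul_of_nonneg_right (le_max_right _ _) (hH.down m n).le)

lemma smul_add_smul_mem_region_iff {e₁ e₂ : ℂ} (he : cross e₁ e₂ ≠ 0) (x y : ℝ) :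
    x • e₁ + y • e₂ ∈ Triangle.region ![e₁, 0, e₂] ↔ 0 ≤ x ∧ 0 ≤ y ∧ x + y ≤ 1 := by
  rw [Triangle.mem_region_iff]
  constructor
  · rintro ⟨a, b, c, ha, hb, hc, hs, h⟩
    simp only [Matrix.cons_val_zero, Matrix.cons_val_one, Matrix.cons_val, smul_zero,
      add_zero] at h
    have h1 := congrArg (gridCoord e₁ e₂ 0) h
    rw [gridCoord_smul_add_smul he, gridCoord_smul_add_smul he] at h1
    simp only [pow_zero, one_mul, Prod.mk.injEq] at h1
    obtain ⟨rfl, rfl⟩ := h1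
    exact ⟨ha, hc, by linarith⟩
  · rintro ⟨hx, hy, hxy⟩
    exact ⟨x, 1 - x - y, y, hx, by linarith, hy, by ring, by simp⟩

lemma cross_ne_zero_of_affineIndependent {e₁ e₂ : ℂ} (h : AffineIndependent ℝ ![e₁, 0, e₂]) :
    cross e₁ e₂ ≠ 0 := by
  intro h0
  rw [affineIndependent_iff_not_collinear_set] at h
  apply h
  rw [collinear_iff_of_mem (p₀ := (0 : ℂ)) (by simp)]
  by_cases he : e₁ = 0
  · refine ⟨e₂, ?_⟩
    rintro p (hp | hp | hp) <;> rw [hp]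
    · exact ⟨0, by simp [he]⟩
    · exact ⟨0, by simp⟩
    · exact ⟨1, by simp⟩
  · have him : (e₂ / e₁).im = 0 := by
      rw [cross_eq_norm_sq_mul_im he] at h0
      exact (mul_eq_zero.1 h0).resolve_left (by simpa using he)
    refine ⟨e₁, ?_⟩
    rintro p (hp | hp | hp) <;> rw [hp]
    · exact ⟨1, by simp⟩
    · exact ⟨0, by simp⟩
    · refine ⟨(e₂ / e₁).re, ?_⟩
      have : ((e₂ / e₁).re : ℂ) = e₂ / e₁ := Complex.ext (by simp) (by simp [him])
      rw [Complex.real_smul, this, vadd_eq_add, add_zero, div_mul_cancel₀ _ he]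

lemma inSector_div {e₁ e₂ : ℂ} {γ : ℝ} (he : 0 < cross e₁ e₂)
    (h1 : InnerProductGeometry.angle e₁ e₂ < Real.pi / 2)
    (h2 : γ * InnerProductGeometry.angle e₁ e₂ < Real.pi / 2) : InSector γ (e₂ / e₁) := by
  have he1 : e₁ ≠ 0 := by rintro rfl; simp [cross] at he
  have he2 : e₂ ≠ 0 := by rintro rfl; simp [cross] at he
  rw [InnerProductGeometry.angle_comm, Complex.angle_eq_abs_arg he2 he1] at h1 h2
  have hvi : 0 < (e₂ / e₁).im := by
    rw [cross_eq_norm_sq_mul_im he1] at he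
    exact pos_of_mul_pos_right he (by positivity)
  refine ⟨re_pos_of_abs_arg_lt (div_ne_zero he2 he1) h1, hvi.le, ?_⟩
  rwa [abs_of_nonneg (Complex.arg_nonneg_iff.2 hvi.le)] at h2

end PowerMap

theorem mainTheorem4 (ξ η : ℂ) (γ : ℝ) (h : ℂ → ℂ)
    (hT : AffineIndependent ℝ ![ξ, 0, η])
    (hiso : ‖ξ‖ = ‖η‖)
    (hγ : 0 < γ)
    (hγθ : (⌈γ⌉ : ℝ) * EuclideanGeometry.angle ξ 0 η < Real.pi / 2)
    (hθ : EuclideanGeometry.angle ξ 0 η < 60.4 * (Real.pi / 180))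
    (hh : PowerMap.IsPowerBranch γ (PowerMap.Triangle.region ![ξ, 0, η]) h) :
    ∃ K : ℝ, 1 ≤ K ∧ ∀ q : ℕ,
      (∃ g : ℂ → ℂ,
        PowerMap.IsSimplicialInterpolant (PowerMap.subdivision ![ξ, 0, η] q) h g) ∧
      ∀ g : ℂ → ℂ,
        PowerMap.IsSimplicialInterpolant (PowerMap.subdivision ![ξ, 0, η] q) h g →
          Topology.IsEmbedding ((PowerMap.Triangle.region ![ξ, 0, η]).domRestrict g) ∧
          PowerMap.simplicialDistortion (PowerMap.subdivision ![ξ, 0, η] q) g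
            ≤ ENNReal.ofReal K := by
  have hcross := PowerMap.cross_ne_zero_of_affineIndependent hT
  have hangle : EuclideanGeometry.angle ξ 0 η = InnerProductGeometry.angle ξ η := by
    simp [EuclideanGeometry.angle]
  rw [hangle] at hγθ hθ
  have h1 : InnerProductGeometry.angle ξ η < Real.pi / 2 := by
    linarith [Real.pi_pos]
  have h2 : γ * InnerProductGeometry.angle ξ η < Real.pi / 2 :=
    (mul_le_mul_of_nonneg_right (Int.le_ceil γ) (InnerProductGeometry.angle_nonneg _ _)).trans_lt
      hγθ
  have hconv : Convex ℝ (PowerMap.Triangle.region ![ξ, 0, η]) := convex_convexHull ℝ _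
  have hcomp : IsCompact (PowerMap.Triangle.region ![ξ, 0, η]) :=
    (Set.finite_range _).isCompact_convexHull ℝ
  have hF : ∀ q, ∀ t ∈ PowerMap.subdivision ![ξ, 0, η] q, PowerMap.IsGridFace ξ η q t :=
    fun q t ht => (PowerMap.isOrderedGridFace_of_mem_subdivision ξ η q ht).isGridFace
  have hcov := PowerMap.region_subset_iUnion_subdivision ![ξ, 0, η]
  have hR := PowerMap.smul_add_smul_mem_region_iff hcross
  -- The sides are named so that `e₁, e₂` is positively oriented, which puts `e₂ / e₁` in the upper
  -- half plane.
  rcases hcross.lt_or_gt with hneg | hpos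
  · have hpos : 0 < PowerMap.cross η ξ := by
      rw [PowerMap.cross_comm]
      linarith
    rw [InnerProductGeometry.angle_comm] at h1 h2
    refine PowerMap.exists_uniform_distortion_bound hγ hpos (PowerMap.inSector_div hpos h1 h2)
      hconv hcomp (fun x y => ?_) hh (fun q t ht => (hF q t ht).swap) hcov
    rw [add_comm, hR, add_comm x y]
    tauto
  · exact PowerMap.exists_uniform_distortion_bound hγ hpos (PowerMap.inSector_div hpos h1 h2)
      hconv hcomp hR hh hF hcov
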